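/- Let $n\ge 1$ and let $\rho=e^{-V}$ be a probability density on $\mathbb{R}^n$ with respect to Lebesgue measure, where $V:\mathbb{R}^n\to\mathbb{R}\cup\{+\infty\}$ is convex (and $e^{-\infty}=0$). Let $|\cdot|$ be the Euclidean norm, let $\log$ be the natural logarithm, and put $$\mathrm{Var}(\rho):=\inf_{c\in\mathbb{R}^n}\int_{\mathbb{R}^n}|x-c|^2\rho(x)\,dx .$$ Then $\int|x|^2\rho(x)\,dx<\infty$ (so $\mathrm{Var}(\rho)<\infty$), the functions $e^{-\delta|x-m|^2/2}\rho(x)$ and $x\,e^{-\delta|x-m|^2/2}\rho(x)$ of $x$ are integrable for all $\delta\ge 0$ and $m\in\mathbb{R}^n$, and the following hold. (i) For each $\delta>0$ there is a unique $m_\delta\in\mathbb{R}^n$ such that $$\int_{\mathbb{R}^n}x\,e^{-\delta|x-m_\delta|^2/2}\rho(x)\,dx=m_\delta\int_{\mathbb{R}^n}e^{-\delta|x-m_\delta|^2/2}\rho(x)\,dx .$$ (ii) For each $\delta>0$ the map $m\mapsto\int_{\mathbb{R}^n}e^{-\delta|x-m|^2/2}\rho(x)\,dx$ has a unique global maximum,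 at $m_\delta$. (iii) The map $\delta\mapsto m_\delta$ is continuous and locally Lipschitz on $(0,\infty)$: for each $\delta_0>0$ there are a neighbourhood $U\subset(0,\infty)$ of $\delta_0$ and $L<\infty$ such that $|m_{\delta}-m_{\delta'}|\le L|\delta-\delta'|$ for all $\delta,\delta'\in U$. (iv) For each $\delta\ge 0$ (for $\delta=0$, with an arbitrary point $m_0\in\mathbb{R}^n$), $$-\log\left(\int_{\mathbb{R}^n}e^{-\delta|x-m_\delta|^2/2}\rho(x)\,dx\right)\le\begin{cases}\frac{\delta}{2}\mathrm{Var}(\rho)&\text{if }0\le\delta<\frac{n}{\mathrm{Var}(\rho)},\\[2pt]\frac n2\left(1+\log\left(\frac{\delta}{n}\mathrm{Var}(\rho)\right)\right)&\text{if }\delta\ge\frac{n}{\mathrm{Var}(\rho)}.\end{cases}$$ -/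

import Mathlib

open MeasureTheory Set

/-- An extended-real-valued function is a convex function with values in `ℝ ∪ {+∞}`:
it never takes the value `-∞` and its epigraph is convex. -/
def IsConvexFun {n : ℕ} (V : EuclideanSpace ℝ (Fin n) → EReal) : Prop :=
  (∀ x, V x ≠ ⊥) ∧
    Convex ℝ {p : EuclideanSpace ℝ (Fin n) × ℝ | V p.1 ≤ (p.2 : EReal)}

/-- The function `ρ = e^{-V}`, with `e^{-∞} = 0`. -/
noncomputable def expNeg {n : ℕ} (V : EuclideanSpace ℝ (Fin n) → EReal)
    (x : EuclideanSpace ℝ (Fin n)) : ℝ :=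
  (EReal.exp (-(V x))).toReal

/-- The Borel measure `dμ = ρ dx` on `ℝⁿ`. -/
noncomputable def densityMeasure {n : ℕ} (ρ : EuclideanSpace ℝ (Fin n) → ℝ) :
    Measure (EuclideanSpace ℝ (Fin n)) :=
  volume.withDensity (fun x => ENNReal.ofReal (ρ x))

/-- `Var(μ) = inf_c ∫ |x - c|² dμ`. -/
noncomputable def totalVar {n : ℕ} (μ : Measure (EuclideanSpace ℝ (Fin n))) : ℝ :=
  ⨅ c : EuclideanSpace ℝ (Fin n), ∫ x, ‖x - c‖ ^ 2 ∂μ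

/-- The unnormalized density `x ↦ e^{-δ|x-m|²/2} ρ(x)`. -/
noncomputable def tilt {n : ℕ} (ρ : EuclideanSpace ℝ (Fin n) → ℝ) (δ : ℝ)
    (m x : EuclideanSpace ℝ (Fin n)) : ℝ :=
  Real.exp (-(δ * ‖x - m‖ ^ 2 / 2)) * ρ x

/-- `m` is the barycenter of the density proportional to `x ↦ e^{-δ|x-m|²/2} ρ(x)`:
`∫ x e^{-δ|x-m|²/2} ρ(x) dx = m ∫ e^{-δ|x-m|²/2} ρ(x) dx`. -/
def IsBarycenter {n : ℕ} (ρ : EuclideanSpace ℝ (Fin n) → ℝ) (δ : ℝ)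
    (m : EuclideanSpace ℝ (Fin n)) : Prop :=
  ∫ x, tilt ρ δ m x • x = (∫ x, tilt ρ δ m x) • m

open scoped ENNReal Pointwise InnerProductSpace Topology

/-! Write `F_δ(m) = ∫ e^{-δ|x-m|²/2} ρ(x) dx`. Its gradient in `m` is `δ ∫ (x - m) e^{-δ|x-m|²/2}
ρ(x) dx`, so the barycenter equation says exactly that `m` is a critical point of `F_δ`. Since `F_δ`
is positive and vanishes at infinity, a maximum exists. Along a direction `e` the second derivative
of `log F_δ` is `δ² Var(⟪·, e⟫) - δ|e|²` under the tilted density, so uniqueness follows once that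
variance is strictly less than `|e|²/δ` (`LogConcave.tilt_variance_lt`). The same inequality makes
the `m`-derivative of the first moment invertible, and the implicit function theorem gives the local
Lipschitz property.

The variance bound is reduced to the line by Prékopa's theorem (`LogConcave.lintegral_pi`). There
the density is compared with the Gaussian of variance `1/δ` having the same mass and mean: their
ratio is log-concave, so the density dominates on an interval, and testing the difference against a
quadratic polynomial that changes sign at the ends of the interval orders the variances.

For the bound, Jensen's inequality gives `-log F_δ(c) ≤ (δ/2) ∫ |x - c|² ρ` for every `c`. For large
`δ`, the Gaussian semigroup shows that `δ^{n/2} sup F_δ` is nondecreasing (`tiltMass_le_of_lt`), and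
`δ` is compared with the threshold `n / Var(ρ)`. Finiteness of all moments used comes from
exponential decay of integrable log-concave functions. -/

/-- Log-concavity of an extended nonnegative function. -/
def LogConcave {E : Type*} [AddCommMonoid E] [Module ℝ E] (f : E → ℝ≥0∞) : Prop :=
  ∀ ⦃x y : E⦄ ⦃t : ℝ⦄, 0 < t → t < 1 → f x ^ (1 - t) * f y ^ t ≤ f ((1 - t) • x + t • y)

/-! ### The one-dimensional Brunn-Minkowski inequality -/

/-- With `a = max K` and `b = min L`, the translates `b + K` and `a + L` both lie in `K + L`, on
opposite sides of `a + b`. -/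
theorem Real.volume_add_volume_le_of_isCompact {K L : Set ℝ} (hK : IsCompact K) (hL : IsCompact L)
    (hK' : K.Nonempty) (hL' : L.Nonempty) : volume K + volume L ≤ volume (K + L) := by
  obtain ⟨a, haK, ha⟩ := hK.exists_isGreatest hK'
  obtain ⟨b, hbL, hb⟩ := hL.exists_isLeast hL'
  have h1 : volume ((b + ·) '' K) = volume K := by
    rw [image_add_left]; exact measure_preimage_add _ _ _
  have h2 : volume ((a + ·) '' L) = volume L := by
    rw [image_add_left]; exact measure_preimage_add _ _ _
  have hdis : AEDisjoint volume ((b + ·) '' K) ((a + ·) '' L) := by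
    refine measure_mono_null (t := {a + b}) ?_ (by simp)
    rintro _ ⟨⟨x, hx, rfl⟩, ⟨y, hy, h⟩⟩
    have := ha hx
    have := hb hy
    simp only [mem_singleton_iff] at *
    linarith
  rw [← h1, ← h2, ← measure_union₀
    ((hL.image (continuous_const_add a)).measurableSet.nullMeasurableSet) hdis]
  apply measure_mono
  rintro _ (⟨x, hx, rfl⟩ | ⟨y, hy, rfl⟩)
  · exact ⟨x, hx, b, hbL, add_comm _ _⟩
  · exact ⟨a, haK, y, hy, rfl⟩

theorem Real.volume_add_volume_le {A B : Set ℝ} (hA : MeasurableSet A) (hB : MeasurableSet B)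
    (hA' : A.Nonempty) (hB' : B.Nonempty) : volume A + volume B ≤ volume (A + B) := by
  obtain ⟨a, ha⟩ := hA'
  obtain ⟨b, hb⟩ := hB'
  rw [hA.measure_eq_iSup_isCompact, hB.measure_eq_iSup_isCompact]
  simp only [iSup_and']
  refine ENNReal.biSup_add_biSup_le' (p := fun K : Set ℝ => K ⊆ A ∧ IsCompact K)
    (q := fun K : Set ℝ => K ⊆ B ∧ IsCompact K)
    ⟨∅, empty_subset _, isCompact_empty⟩ ⟨∅, empty_subset _, isCompact_empty⟩ ?_
  rintro K ⟨hKA, hK⟩ L ⟨hLB, hL⟩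
  -- The approximating compact sets may be empty; adjoining fixed points of `A` and `B` repairs
  -- this.
  calc volume K + volume L ≤ volume (insert a K) + volume (insert b L) := by
        gcongr <;> exact subset_insert _ _
    _ ≤ volume (insert a K + insert b L) :=
        Real.volume_add_volume_le_of_isCompact (hK.insert a) (hL.insert b)
          (insert_nonempty _ _) (insert_nonempty _ _)
    _ ≤ volume (A + B) := by
        gcongr
        · exact insert_subset ha hKA
        · exact insert_subset hb hLB

theorem Real.weighted_volume_add_le {A B C : Set ℝ} (hA : MeasurableSet A) (hB : MeasurableSet B)
    (hA' : A.Nonempty) (hB' : B.Nonempty) {t : ℝ} (ht : 0 < t) (ht' : t < 1)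
    (hC : ∀ x ∈ A, ∀ y ∈ B, (1 - t) * x + t * y ∈ C) :
    ENNReal.ofReal (1 - t) * volume A + ENNReal.ofReal t * volume B ≤ volume C := by
  have h1 : volume ((1 - t) • A) = ENNReal.ofReal (1 - t) * volume A := by
    rw [Measure.addHaar_smul]; simp [abs_of_pos (sub_pos.2 ht')]
  have h2 : volume (t • B) = ENNReal.ofReal t * volume B := by
    rw [Measure.addHaar_smul]; simp [abs_of_pos ht]
  rw [← h1, ← h2]
  refine (Real.volume_add_volume_le (hA.const_smul₀ _) (hB.const_smul₀ _) hA'.smul_set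
    hB'.smul_set).trans (measure_mono ?_)
  rintro _ ⟨_, ⟨x, hx, rfl⟩, _, ⟨y, hy, rfl⟩, rfl⟩
  exact hC x hx y hy

/-! ### The one-dimensional Prékopa-Leindler inequality -/

/-- Layer-cake formula: Tonelli applied to the region under the graph, with the value `⊤` allowed.
-/
theorem MeasureTheory.lintegral_eq_lintegral_meas_ofReal_lt {α : Type*} [MeasurableSpace α]
    (μ : Measure α) [SFinite μ] {f : α → ℝ≥0∞} (hf : Measurable f) :
    ∫⁻ x, f x ∂μ = ∫⁻ s in Ioi (0 : ℝ), μ {x | ENNReal.ofReal s < f x} := by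
  have hS : MeasurableSet {p : ℝ × α | ENNReal.ofReal p.1 < f p.2} :=
    measurableSet_lt (by fun_prop) (by fun_prop)
  have key : ∀ a : ℝ≥0∞, volume ({s : ℝ | ENNReal.ofReal s < a} ∩ Ioi 0) = a := by
    intro a
    induction a using ENNReal.recTopCoe with
    | top =>
      have : ({s : ℝ | ENNReal.ofReal s < ⊤} ∩ Ioi 0) = Ioi 0 := by
        ext s; simp
      rw [this]; simp
    | coe a =>
      have : ({s : ℝ | ENNReal.ofReal s < a} ∩ Ioi 0) = Ioo 0 (a : ℝ) := by
        ext s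
        simp only [mem_inter_iff, mem_ofPred_eq, mem_Ioi, mem_Ioo]
        rw [and_comm]
        refine and_congr_right fun hs => ?_
        rw [← ENNReal.ofReal_coe_nnreal, ENNReal.ofReal_lt_ofReal_iff_of_nonneg hs.le]
      rw [this]; simp
  calc ∫⁻ x, f x ∂μ
      = ∫⁻ x, (∫⁻ s in Ioi (0 : ℝ),
          {p : ℝ × α | ENNReal.ofReal p.1 < f p.2}.indicator 1 (s, x)) ∂μ := by
        refine lintegral_congr fun x => ?_
        rw [← key (f x), ← Measure.restrict_apply
          (measurableSet_lt (by fun_prop) measurable_const), ← lintegral_indicator_one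
          (measurableSet_lt (by fun_prop) measurable_const)]
        rfl
    _ = ∫⁻ s in Ioi (0 : ℝ), ∫⁻ x,
          {p : ℝ × α | ENNReal.ofReal p.1 < f p.2}.indicator 1 (s, x) ∂μ := by
        rw [lintegral_lintegral_swap]
        exact ((measurable_one.indicator hS).comp measurable_swap).aemeasurable
    _ = _ := by
        refine lintegral_congr fun s => ?_
        rw [← lintegral_indicator_one (measurableSet_lt measurable_const hf)]
        rfl

theorem ENNReal.geom_mean_le_arith_mean2 (a b : ℝ≥0∞) {t : ℝ} (ht : 0 < t) (ht' : t < 1) :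
    a ^ (1 - t) * b ^ t ≤ ENNReal.ofReal (1 - t) * a + ENNReal.ofReal t * b := by
  have h1 : 0 < 1 - t := sub_pos.2 ht'
  by_cases ha : a = ⊤
  · rw [ha, ENNReal.mul_top (by simpa using ht')]; simp
  by_cases hb : b = ⊤
  · rw [hb, ENNReal.mul_top (by simpa using ht)]; simp
  lift a to NNReal using ha
  lift b to NNReal using hb
  have := NNReal.geom_mean_le_arith_mean2_weighted (Real.toNNReal (1 - t)) (Real.toNNReal t) a b
    (by rw [← Real.toNNReal_add h1.le ht.le]; simp)
  rw [Real.coe_toNNReal _ h1.le, Real.coe_toNNReal _ ht.le] at this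
  rw [← ENNReal.coe_rpow_of_nonneg _ h1.le, ← ENNReal.coe_rpow_of_nonneg _ ht.le]
  simpa only [ENNReal.ofReal, ← ENNReal.coe_mul, ← ENNReal.coe_add, ENNReal.coe_le_coe] using this

/-- The case of bounded functions. -/
theorem Real.prekopa_leindler_of_bdd {f g h : ℝ → ℝ≥0∞} (hf : Measurable f) (hg : Measurable g)
    (hh : Measurable h) {t : ℝ} (ht : 0 < t) (ht' : t < 1)
    (hfg : ∀ x y, f x ^ (1 - t) * g y ^ t ≤ h ((1 - t) * x + t * y))
    (hfb : ⨆ x, f x ≠ ⊤) (hgb : ⨆ x, g x ≠ ⊤) :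
    (∫⁻ x, f x) ^ (1 - t) * (∫⁻ x, g x) ^ t ≤ ∫⁻ x, h x := by
  have h1 : 0 < 1 - t := sub_pos.2 ht'
  set A := ⨆ x, f x with hA
  set B := ⨆ x, g x with hB
  by_cases hA0 : A = 0
  · have : ∀ x, f x = 0 := fun x => nonpos_iff_eq_zero.1 (hA0 ▸ le_iSup f x)
    simp [this, ENNReal.zero_rpow_of_pos h1]
  by_cases hB0 : B = 0
  · have : ∀ x, g x = 0 := fun x => nonpos_iff_eq_zero.1 (hB0 ▸ le_iSup g x)
    simp [this, ENNReal.zero_rpow_of_pos ht]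
  set C := A ^ (1 - t) * B ^ t with hC
  have hC0 : C ≠ 0 := by
    simp [hC, ENNReal.rpow_eq_zero_iff, hA0, hB0, hfb, hgb]
  have hCt : C ≠ ⊤ := ENNReal.mul_ne_top (ENNReal.rpow_ne_top_of_nonneg h1.le hfb)
    (ENNReal.rpow_ne_top_of_nonneg ht.le hgb)
  -- Once both suprema are normalized to 1, the superlevel sets of `f / A` and `g / B` are both
  -- nonempty at levels below 1 and both empty from level 1 on. Brunn-Minkowski thus applies level
  -- by level and gives an arithmetic-mean inequality, stronger than the geometric one.
  have main : ENNReal.ofReal (1 - t) * (∫⁻ x, f x / A) + ENNReal.ofReal t * (∫⁻ x, g x / B) ≤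
      ∫⁻ x, h x / C := by
    rw [lintegral_eq_lintegral_meas_ofReal_lt _ (hf.div_const A),
      lintegral_eq_lintegral_meas_ofReal_lt _ (hg.div_const B),
      lintegral_eq_lintegral_meas_ofReal_lt _ (hh.div_const C)]
    have m1 : ∀ {u : ℝ → ℝ≥0∞}, Measurable fun s : ℝ => volume {x | ENNReal.ofReal s < u x} :=
      fun {u} => (Antitone.measurable fun s s' hs => measure_mono fun x hx =>
        (ENNReal.ofReal_le_ofReal hs).trans_lt hx)
    rw [← lintegral_const_mul _ m1, ← lintegral_const_mul _ m1, ← lintegral_add_left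
      (m1.const_mul _)]
    refine setLIntegral_mono m1 fun s (hs : 0 < s) => ?_
    by_cases hs1 : s < 1
    · have hs1' : ENNReal.ofReal s < 1 := by simpa using hs1
      have hne : ∀ {u : ℝ → ℝ≥0∞}, ⨆ x, u x ≠ 0 → ⨆ x, u x ≠ ⊤ →
          {x | ENNReal.ofReal s < u x / ⨆ x, u x}.Nonempty := by
        intro u h0 htop
        have : ENNReal.ofReal s * (⨆ x, u x) < ⨆ x, u x := by
          conv_rhs => rw [← one_mul (⨆ x, u x)]
          exact ENNReal.mul_lt_mul_left h0 htop hs1'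
        obtain ⟨x, hx⟩ := lt_iSup_iff.1 this
        refine ⟨x, ?_⟩
        rw [mem_ofPred_eq, ENNReal.lt_div_iff_mul_lt (Or.inl h0) (Or.inl htop)]
        exact hx
      refine Real.weighted_volume_add_le (measurableSet_lt measurable_const (hf.div_const A))
        (measurableSet_lt measurable_const (hg.div_const B)) (hne hA0 hfb) (hne hB0 hgb) ht ht' ?_
      intro x hx y hy
      rw [mem_ofPred_eq, ENNReal.lt_div_iff_mul_lt (Or.inl hA0) (Or.inl hfb)] at hx
      rw [mem_ofPred_eq, ENNReal.lt_div_iff_mul_lt (Or.inl hB0) (Or.inl hgb)] at hy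
      rw [mem_ofPred_eq, ENNReal.lt_div_iff_mul_lt (Or.inl hC0) (Or.inl hCt)]
      refine lt_of_lt_of_le ?_ (hfg x y)
      have e : ENNReal.ofReal s * C = (ENNReal.ofReal s * A) ^ (1 - t) *
          (ENNReal.ofReal s * B) ^ t := by
        rw [ENNReal.mul_rpow_of_nonneg _ _ h1.le, ENNReal.mul_rpow_of_nonneg _ _ ht.le, hC]
        have : ENNReal.ofReal s = ENNReal.ofReal s ^ (1 - t) * ENNReal.ofReal s ^ t := by
          rw [← ENNReal.rpow_add_of_nonneg _ _ h1.le ht.le]; simp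
        nth_rw 1 [this]
        ring
      rw [e]
      exact ENNReal.mul_lt_mul (ENNReal.rpow_lt_rpow hx h1) (ENNReal.rpow_lt_rpow hy ht)
    · have hs2 : (1 : ℝ≥0∞) ≤ ENNReal.ofReal s := by simpa using hs1
      have hem : ∀ {u : ℝ → ℝ≥0∞}, {x | ENNReal.ofReal s < u x / ⨆ x, u x} = ∅ := by
        intro u
        ext x
        simp only [mem_ofPred_eq, mem_empty_iff_false, iff_false, not_lt]
        exact (ENNReal.div_le_of_le_mul (by simpa using le_iSup u x)).trans hs2
      simp only [hA, hB, hem]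
      simp
  have := (ENNReal.geom_mean_le_arith_mean2 (∫⁻ x, f x / A) (∫⁻ x, g x / B) ht ht').trans main
  simp only [div_eq_mul_inv] at this
  rw [lintegral_mul_const _ hf, lintegral_mul_const _ hg, lintegral_mul_const _ hh,
    ENNReal.mul_rpow_of_nonneg _ _ h1.le, ENNReal.mul_rpow_of_nonneg _ _ ht.le,
    ENNReal.inv_rpow, ENNReal.inv_rpow] at this
  have hC' : (A ^ (1 - t))⁻¹ * (B ^ t)⁻¹ = C⁻¹ := by
    rw [hC, ENNReal.mul_inv]
    · right; exact ENNReal.rpow_ne_top_of_nonneg ht.le hgb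
    · left; exact ENNReal.rpow_ne_top_of_nonneg h1.le hfb
  rw [mul_mul_mul_comm, hC'] at this
  exact (ENNReal.mul_le_mul_iff_left (ENNReal.inv_ne_zero.2 hCt)
    (ENNReal.inv_ne_top.2 hC0)).1 this

theorem Real.prekopa_leindler {f g h : ℝ → ℝ≥0∞} (hf : Measurable f) (hg : Measurable g)
    (hh : Measurable h) {t : ℝ} (ht : 0 < t) (ht' : t < 1)
    (hfg : ∀ x y, f x ^ (1 - t) * g y ^ t ≤ h ((1 - t) * x + t * y)) :
    (∫⁻ x, f x) ^ (1 - t) * (∫⁻ x, g x) ^ t ≤ ∫⁻ x, h x := by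
  have h1 : 0 < 1 - t := sub_pos.2 ht'
  have lim : ∀ {u : ℝ → ℝ≥0∞}, Measurable u →
      Filter.Tendsto (fun n : ℕ => ∫⁻ x, min (u x) n) Filter.atTop (nhds (∫⁻ x, u x)) := by
    intro u hu
    refine lintegral_tendsto_of_tendsto_of_monotone (fun n => (hu.min measurable_const).aemeasurable)
      (ae_of_all _ fun x m n hmn => min_le_min_left _ (by exact_mod_cast hmn))
      (ae_of_all _ fun x => ?_)
    have := (tendsto_const_nhds (x := u x)).min ENNReal.tendsto_nat_nhds_top
    simpa using this
  have bdd : ∀ {u : ℝ → ℝ≥0∞} (n : ℕ), ⨆ x, min (u x) n ≠ ⊤ := fun {u} n =>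
    ((iSup_le fun x => min_le_right (u x) n).trans_lt (ENNReal.natCast_lt_top n)).ne
  -- Truncating `f` and `g` preserves the hypothesis with the same `h`; monotone convergence then
  -- removes the truncation.
  have step : ∀ n m : ℕ, (∫⁻ x, min (f x) n) ^ (1 - t) * (∫⁻ x, min (g x) m) ^ t ≤ ∫⁻ x, h x :=
    fun n m => Real.prekopa_leindler_of_bdd (hf.min measurable_const) (hg.min measurable_const) hh
      ht ht' (fun x y => le_trans (by gcongr <;> exact min_le_left _ _) (hfg x y)) (bdd n) (bdd m)
  by_cases hf0 : ∫⁻ x, f x = 0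
  · simp [hf0, ENNReal.zero_rpow_of_pos h1]
  by_cases hg0 : ∫⁻ x, g x = 0
  · simp [hg0, ENNReal.zero_rpow_of_pos ht]
  refine le_of_tendsto (ENNReal.Tendsto.mul (((ENNReal.continuous_rpow_const).tendsto _).comp
    (lim hf)) (Or.inl ?_) (((ENNReal.continuous_rpow_const).tendsto _).comp (lim hg)) (Or.inl ?_))
    (Filter.Eventually.of_forall fun n => step n n)
  · simp [ENNReal.rpow_eq_zero_iff, hf0, h1.not_gt]
  · simp [ENNReal.rpow_eq_zero_iff, hg0, ht.not_gt]

/-! ### Marginals of log-concave functions -/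

theorem LogConcave.lintegral_real {E : Type*} [AddCommMonoid E] [Module ℝ E] {f : E × ℝ → ℝ≥0∞}
    (hf : LogConcave f) (hm : ∀ x, Measurable fun s => f (x, s)) :
    LogConcave fun x => ∫⁻ s, f (x, s) := fun _ _ _ ht ht' =>
  Real.prekopa_leindler (hm _) (hm _) (hm _) ht ht' fun a b => hf (x := (_, a)) (y := (_, b)) ht ht'

theorem LogConcave.comp_linearMap {E F : Type*} [AddCommMonoid E] [Module ℝ E] [AddCommMonoid F]
    [Module ℝ F] {f : F → ℝ≥0∞} (hf : LogConcave f) (L : E →ₗ[ℝ] F) :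
    LogConcave fun x => f (L x) := fun x y t ht ht' => by
  simpa using hf (x := L x) (y := L y) ht ht'

/-- Prékopa's theorem: marginals of log-concave functions are log-concave. -/
theorem LogConcave.lintegral_pi (k : ℕ) {E : Type} [AddCommMonoid E] [Module ℝ E]
    {f : E × (Fin k → ℝ) → ℝ≥0∞} (hf : LogConcave f) (hm : ∀ x, Measurable fun y => f (x, y)) :
    LogConcave fun x => ∫⁻ y, f (x, y) := by
  induction k generalizing E with
  | zero =>
    have : ∀ x, ∫⁻ y, f (x, y) = f (x, 0) := fun x => by
      rw [lintegral_congr (g := fun _ => f (x, 0)) fun y => by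
        rw [Subsingleton.elim y (0 : Fin 0 → ℝ)], lintegral_const]
      simp [volume_pi]
    simp only [this]
    exact hf.comp_linearMap (LinearMap.inl ℝ E (Fin 0 → ℝ))
  | succ k ih =>
    let e := MeasurableEquiv.piFinSuccAbove (fun _ : Fin (k + 1) => ℝ) 0
    have he : MeasurePreserving e.symm :=
      (volume_preserving_piFinSuccAbove (fun _ : Fin (k + 1) => ℝ) 0).symm
    have hcons : ∀ s : ℝ, ∀ y : Fin k → ℝ, e.symm (s, y) = Fin.cons s y := by
      intro s y
      simp [e, MeasurableEquiv.piFinSuccAbove, Fin.insertNthEquiv]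
    -- One coordinate is integrated first, the other `k` joining the parameters, so the
    -- one-dimensional case applies before the induction hypothesis.
    let G : (E × (Fin k → ℝ)) × ℝ → ℝ≥0∞ := fun p => f (p.1.1, Fin.cons p.2 p.1.2)
    have hmc : ∀ x, Measurable fun p : (Fin k → ℝ) × ℝ => G ((x, p.1), p.2) := by
      intro x
      have : (fun p : (Fin k → ℝ) × ℝ => G ((x, p.1), p.2)) =
          fun p => f (x, e.symm p.swap) := by
        ext p; simp [G, Prod.swap, hcons]
      rw [this]
      exact (hm x).comp (e.symm.measurable.comp measurable_swap)
    have hG : LogConcave G := by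
      rintro ⟨⟨x, y⟩, s⟩ ⟨⟨x', y'⟩, s'⟩ t ht ht'
      have := hf (x := (x, Fin.cons s y)) (y := (x', Fin.cons s' y')) ht ht'
      refine this.trans (le_of_eq ?_)
      simp only [G, Prod.smul_mk, Prod.mk_add_mk]
      congr 2
      ext i
      refine Fin.cases ?_ (fun j => ?_) i <;> simp
    have := ih (E := E) (f := fun p => ∫⁻ s, G (p, s))
      (hG.lintegral_real fun p => (hmc p.1).comp measurable_prodMk_left)
      (fun x => (hmc x).lintegral_prod_right')
    convert this using 2 with x
    rw [← he.lintegral_comp (hm x), Measure.volume_eq_prod,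
      lintegral_prod_symm' (fun p => f (x, e.symm p)) ((hm x).comp e.symm.measurable)]
    simp [G, hcons]

theorem LogConcave.mul {E : Type*} [AddCommMonoid E] [Module ℝ E] {f g : E → ℝ≥0∞}
    (hf : LogConcave f) (hg : LogConcave g) : LogConcave fun x => f x * g x :=
  fun x y t ht ht' => by
  rw [ENNReal.mul_rpow_of_nonneg _ _ (sub_nonneg.2 ht'.le), ENNReal.mul_rpow_of_nonneg _ _ ht.le,
    mul_mul_mul_comm]
  exact mul_le_mul' (hf ht ht') (hg ht ht')

theorem ConvexOn.logConcave_exp_neg {E : Type*} [AddCommMonoid E] [Module ℝ E] {φ : E → ℝ}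
    (hφ : ConvexOn ℝ univ φ) : LogConcave fun x => ENNReal.ofReal (Real.exp (-φ x)) :=
  fun x y t ht ht' => by
  rw [ENNReal.ofReal_rpow_of_pos (Real.exp_pos _), ENNReal.ofReal_rpow_of_pos (Real.exp_pos _),
    ← ENNReal.ofReal_mul (by positivity), ← Real.exp_mul, ← Real.exp_mul, ← Real.exp_add]
  refine ENNReal.ofReal_le_ofReal (Real.exp_le_exp.2 ?_)
  have := hφ.2 (mem_univ x) (mem_univ y) (sub_nonneg.2 ht'.le) ht.le (by ring)
  simp only [smul_eq_mul] at this
  linarith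

theorem LogConcave.min_le {E : Type*} [AddCommMonoid E] [Module ℝ E] {f : E → ℝ≥0∞}
    (hf : LogConcave f) (x y : E) {t : ℝ} (ht : 0 < t) (ht' : t < 1) :
    min (f x) (f y) ≤ f ((1 - t) • x + t • y) := by
  refine le_trans ?_ (hf ht ht')
  have : min (f x) (f y) = min (f x) (f y) ^ (1 - t) * min (f x) (f y) ^ t := by
    rw [← ENNReal.rpow_add_of_nonneg _ _ (sub_nonneg.2 ht'.le) ht.le]; simp
  rw [this]
  have := sub_nonneg.2 ht'.le
  gcongr
  · exact min_le_left _ _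
  · exact min_le_right _ _

theorem LogConcave.convex_superlevel {E : Type*} [AddCommMonoid E] [Module ℝ E] {f : E → ℝ≥0∞}
    (hf : LogConcave f) (c : ℝ≥0∞) : Convex ℝ {x | c ≤ f x} := by
  intro x hx y hy a b ha hb hab
  rcases hb.eq_or_lt with rfl | hb
  · obtain rfl : a = 1 := by linarith
    simpa using hx
  rcases ha.eq_or_lt with rfl | ha
  · obtain rfl : b = 1 := by linarith
    simpa using hy
  obtain rfl : a = 1 - b := by linarith
  exact (le_min hx hy).trans (hf.min_le x y hb (by linarith))

theorem ofReal_expNeg {n : ℕ} {V : EuclideanSpace ℝ (Fin n) → EReal} (hV : ∀ x, V x ≠ ⊥)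
    (x : EuclideanSpace ℝ (Fin n)) : ENNReal.ofReal (expNeg V x) = EReal.exp (-(V x)) := by
  refine ENNReal.ofReal_toReal fun h => hV x ?_
  rwa [EReal.exp_eq_top_iff, EReal.neg_eq_top_iff] at h

theorem IsConvexFun.logConcave {n : ℕ} {V : EuclideanSpace ℝ (Fin n) → EReal}
    (hV : IsConvexFun V) : LogConcave fun x => ENNReal.ofReal (expNeg V x) := by
  intro x y t ht ht'
  simp only [ofReal_expNeg hV.1]
  have h1 : 0 < 1 - t := sub_pos.2 ht'
  by_cases hx : V x = ⊤
  · simp [hx, ENNReal.zero_rpow_of_pos h1]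
  by_cases hy : V y = ⊤
  · simp [hy, ENNReal.zero_rpow_of_pos ht]
  obtain ⟨u, hu⟩ : ∃ u : ℝ, V x = u := ⟨_, (EReal.coe_toReal hx (hV.1 x)).symm⟩
  obtain ⟨v, hv⟩ : ∃ v : ℝ, V y = v := ⟨_, (EReal.coe_toReal hy (hV.1 y)).symm⟩
  have := hV.2 (x := (x, u)) (y := (y, v)) (by simp [hu]) (by simp [hv]) h1.le ht.le (by ring)
  simp only [Prod.smul_mk, Prod.mk_add_mk, mem_ofPred_eq, smul_eq_mul] at this
  rw [hu, hv]
  calc EReal.exp (-(u : EReal)) ^ (1 - t) * EReal.exp (-(v : EReal)) ^ t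
      = EReal.exp (-(((1 - t) * u + t * v : ℝ) : EReal)) := by
        rw [← EReal.coe_neg, ← EReal.coe_neg, ← EReal.coe_neg, EReal.exp_coe, EReal.exp_coe,
          EReal.exp_coe, ENNReal.ofReal_rpow_of_pos (Real.exp_pos _),
          ENNReal.ofReal_rpow_of_pos (Real.exp_pos _), ← ENNReal.ofReal_mul (by positivity),
          ← Real.exp_mul, ← Real.exp_mul, ← Real.exp_add]
        congr 2; ring
    _ ≤ _ := EReal.exp_monotone (EReal.neg_le_neg_iff.2 this)

/-! ### Real-valued log-concave functions. -/

section Real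

variable {E : Type*} [AddCommGroup E] [Module ℝ E] {ρ : E → ℝ}

theorem LogConcave.rpow_mul_rpow_le (hρ : LogConcave fun x => ENNReal.ofReal (ρ x))
    (h0 : ∀ x, 0 ≤ ρ x) (x y : E) {t : ℝ} (ht : 0 < t) (ht' : t < 1) :
    ρ x ^ (1 - t) * ρ y ^ t ≤ ρ ((1 - t) • x + t • y) := by
  have := hρ (x := x) (y := y) ht ht'
  have h1 := sub_nonneg.2 ht'.le
  rwa [ENNReal.ofReal_rpow_of_nonneg (h0 _) h1, ENNReal.ofReal_rpow_of_nonneg (h0 _) ht.le,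
    ← ENNReal.ofReal_mul (Real.rpow_nonneg (h0 _) _), ENNReal.ofReal_le_ofReal_iff (h0 _)] at this

theorem logConcave_ofReal_iff (h0 : ∀ x, 0 ≤ ρ x) :
    LogConcave (fun x => ENNReal.ofReal (ρ x)) ↔ ∀ (x y : E) (t : ℝ), 0 < t → t < 1 →
      ρ x ^ (1 - t) * ρ y ^ t ≤ ρ ((1 - t) • x + t • y) := by
  refine ⟨fun h x y t => h.rpow_mul_rpow_le h0 x y, fun h x y t ht ht' => ?_⟩
  have h1 := sub_nonneg.2 ht'.le
  rw [ENNReal.ofReal_rpow_of_nonneg (h0 _) h1, ENNReal.ofReal_rpow_of_nonneg (h0 _) ht.le,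
    ← ENNReal.ofReal_mul (Real.rpow_nonneg (h0 _) _)]
  exact ENNReal.ofReal_le_ofReal (h x y t ht ht')

theorem LogConcave.convex_superlevel_real (hρ : LogConcave fun x => ENNReal.ofReal (ρ x))
    (h0 : ∀ x, 0 ≤ ρ x) (c : ℝ) : Convex ℝ {x | c ≤ ρ x} := by
  convert hρ.convex_superlevel (ENNReal.ofReal c) using 1
  ext x
  simp [ENNReal.ofReal_le_ofReal_iff (h0 x)]

theorem LogConcave.convex_pos (hρ : LogConcave fun x => ENNReal.ofReal (ρ x))
    (h0 : ∀ x, 0 ≤ ρ x) : Convex ℝ {x | 0 < ρ x} := by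
  intro x hx y hy a b ha hb hab
  have hx' : 0 < ρ x := hx
  have hy' : 0 < ρ y := hy
  have := hρ.convex_superlevel_real h0 (min (ρ x) (ρ y)) (x := x) (y := y)
    (show min (ρ x) (ρ y) ≤ ρ x from min_le_left _ _)
    (show min (ρ x) (ρ y) ≤ ρ y from min_le_right _ _) ha hb hab
  exact (lt_min hx' hy').trans_le this

theorem LogConcave.concaveOn_log (hρ : LogConcave fun x => ENNReal.ofReal (ρ x))
    (h0 : ∀ x, 0 ≤ ρ x) : ConcaveOn ℝ {x | 0 < ρ x} fun x => Real.log (ρ x) := by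
  refine ⟨hρ.convex_pos h0, fun x hx y hy a b ha hb hab => ?_⟩
  rcases hb.eq_or_lt with rfl | hb
  · obtain rfl : a = 1 := by linarith
    simp
  rcases ha.eq_or_lt with rfl | ha
  · obtain rfl : b = 1 := by linarith
    simp
  obtain rfl : a = 1 - b := by linarith
  have hx' : 0 < ρ x := hx
  have hy' : 0 < ρ y := hy
  have := Real.log_le_log (by positivity) (hρ.rpow_mul_rpow_le h0 x y hb (by linarith))
  rwa [Real.log_mul (by positivity) (by positivity), Real.log_rpow hx', Real.log_rpow hy'] at this

end Real

/-! ### Regularity, decay and moments of log-concave functions in finite dimension. -/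

section FiniteDim

variable {E : Type*} [NormedAddCommGroup E] [NormedSpace ℝ E] [FiniteDimensional ℝ E]
  [MeasurableSpace E] [BorelSpace E] (μ : Measure E) [μ.IsAddHaarMeasure] {ρ : E → ℝ}

/-- A log-concave function is continuous in the interior of its convex positivity set, whose
frontier is null, so cutting it off to that interior changes it on a null set only. Prékopa's
theorem needs genuinely measurable fibres. -/
theorem LogConcave.exists_measurable_ae_eq (hρ : LogConcave fun x => ENNReal.ofReal (ρ x))
    (h0 : ∀ x, 0 ≤ ρ x) : ∃ ρ' : E → ℝ, Measurable ρ' ∧ (∀ x, 0 ≤ ρ' x) ∧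
      (LogConcave fun x => ENNReal.ofReal (ρ' x)) ∧ ρ' =ᵐ[μ] ρ := by
  have hconv := hρ.convex_pos h0
  have hUpos : ∀ x ∈ interior {x | 0 < ρ x}, 0 < ρ x := fun x hx =>
    interior_subset (s := {x | 0 < ρ x}) hx
  have hnn : ∀ x, 0 ≤ (interior {x | 0 < ρ x}).indicator ρ x :=
    indicator_nonneg fun x _ => h0 x
  refine ⟨(interior {x | 0 < ρ x}).indicator ρ, ?_, hnn, ?_, ?_⟩
  · have hc : ContinuousOn ρ (interior {x | 0 < ρ x}) := by
      have h1 : ContinuousOn (fun x => Real.log (ρ x)) (interior {x | 0 < ρ x}) :=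
        ((hρ.concaveOn_log h0).subset interior_subset hconv.interior).continuousOn isOpen_interior
      exact (Real.continuous_exp.comp_continuousOn h1).congr fun x hx =>
        (Real.exp_log (hUpos x hx)).symm
    classical
    rw [← piecewise_eq_indicator]
    exact hc.measurable_piecewise continuousOn_const isOpen_interior.measurableSet
  · rw [logConcave_ofReal_iff hnn]
    intro x y t ht ht'
    by_cases hx : x ∈ interior {x | 0 < ρ x}
    · by_cases hy : y ∈ interior {x | 0 < ρ x}
      · have hz := hconv.interior hx hy (sub_nonneg.2 ht'.le) ht.le (by ring)
        rw [indicator_of_mem hx, indicator_of_mem hy, indicator_of_mem hz]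
        exact hρ.rpow_mul_rpow_le h0 x y ht ht'
      · rw [indicator_of_notMem hy, Real.zero_rpow ht.ne', mul_zero]
        exact hnn _
    · rw [indicator_of_notMem hx, Real.zero_rpow (sub_pos.2 ht').ne', zero_mul]
      exact hnn _
  · have : ∀ᵐ x ∂μ, x ∉ frontier {x | 0 < ρ x} := measure_eq_zero_iff_ae_notMem.1
      (hconv.addHaar_frontier μ)
    filter_upwards [this] with x hx
    by_cases hxi : x ∈ interior {x | 0 < ρ x}
    · rw [indicator_of_mem hxi]
    · rw [indicator_of_notMem hxi]
      have : x ∉ {x | 0 < ρ x} := fun h => hx ⟨subset_closure h, hxi⟩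
      exact le_antisymm (h0 x) (not_lt.1 this)

/-- Some superlevel set of a nonzero log-concave function contains a ball. -/
theorem LogConcave.exists_ball_le (hρ : LogConcave fun x => ENNReal.ofReal (ρ x))
    (h0 : ∀ x, 0 ≤ ρ x) (hne : ¬ ρ =ᵐ[μ] 0) :
    ∃ c > 0, ∃ x₀, ∃ r > 0, ∀ x ∈ Metric.ball x₀ r, c ≤ ρ x := by
  obtain ⟨k, hk⟩ : ∃ k : ℕ, μ {x | 1 / ((k : ℝ) + 1) ≤ ρ x} ≠ 0 := by
    by_contra! h
    refine hne ?_
    have : ∀ᵐ x ∂μ, ∀ k : ℕ, x ∉ {x | 1 / ((k : ℝ) + 1) ≤ ρ x} :=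
      ae_all_iff.2 fun k => measure_eq_zero_iff_ae_notMem.1 (h k)
    filter_upwards [this] with x hx
    refine le_antisymm (le_of_forall_pos_lt_add fun ε hε => ?_) (h0 x)
    obtain ⟨k, hk⟩ := exists_nat_one_div_lt hε
    have := hx k
    simp only [not_le] at this
    simp only [Pi.zero_apply, zero_add]
    linarith
  have hconv := hρ.convex_superlevel_real h0 (1 / ((k : ℝ) + 1))
  -- A convex set with empty interior lies in its own frontier, which is null.
  have hint : (interior {x | 1 / ((k : ℝ) + 1) ≤ ρ x}).Nonempty := by
    by_contra hem
    rw [not_nonempty_iff_eq_empty] at hem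
    refine hk (measure_mono_null ?_ (hconv.addHaar_frontier μ))
    rw [frontier, hem, sdiff_empty]
    exact subset_closure
  obtain ⟨x₀, hx₀⟩ := hint
  obtain ⟨r, hr, hball⟩ := Metric.isOpen_iff.1 isOpen_interior x₀ hx₀
  exact ⟨1 / ((k : ℝ) + 1), by positivity, x₀, r, hr, fun x hx =>
    interior_subset (s := {x | 1 / ((k : ℝ) + 1) ≤ ρ x}) (hball hx)⟩

/-- If `c' ≤ ρ x` with `x` far away, then `c' ≤ ρ` on the convex hull of `x` and the ball, hence on
a ball of radius `r / 2` about the midpoint of `x₀` and `x`. That ball is also far away and carries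
mass at least `c' * v`, against the vanishing of the tails. -/
theorem LogConcave.exists_lt_of_le_norm (hρ : LogConcave fun x => ENNReal.ofReal (ρ x))
    (h0 : ∀ x, 0 ≤ ρ x) (hint : Integrable ρ μ) {c c' r : ℝ} {x₀ : E} (hr : 0 < r) (hc' : 0 < c')
    (hcc : c' ≤ c) (hball : ∀ x ∈ Metric.ball x₀ r, c ≤ ρ x) :
    ∃ R > 0, ∀ x, R ≤ ‖x - x₀‖ → ρ x < c' := by
  have hlim : Filter.Tendsto (fun i : ℕ => ∫ x in (Metric.closedBall x₀ (i : ℝ))ᶜ, ρ x ∂μ)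
      Filter.atTop (nhds 0) := by
    have h1 := tendsto_setIntegral_of_antitone (μ := μ) (f := ρ)
      (s := fun i : ℕ => (Metric.closedBall x₀ (i : ℝ))ᶜ)
      (fun i => Metric.isClosed_closedBall.measurableSet.compl)
      (fun i j hij => compl_subset_compl.2 (Metric.closedBall_subset_closedBall (by exact_mod_cast hij)))
      ⟨0, hint.integrableOn⟩
    have : ⋂ i : ℕ, (Metric.closedBall x₀ (i : ℝ))ᶜ = ∅ := by
      rw [← compl_iUnion, Metric.iUnion_closedBall_nat, compl_univ]
    rw [this] at h1
    simpa using h1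
  set v := μ.real (Metric.ball (0 : E) (r / 2)) with hv
  have hvpos : 0 < v := by
    rw [hv, measureReal_def]
    exact ENNReal.toReal_pos (Metric.measure_ball_pos _ _ (by positivity)).ne'
      (measure_ball_lt_top).ne
  obtain ⟨N, hN⟩ := ((hlim.eventually (gt_mem_nhds (show 0 < c' * v by positivity)))).exists
  refine ⟨2 * (N + r), by positivity, fun x hx => ?_⟩
  by_contra! hcx
  refine absurd hN (not_lt.2 ?_)
  set z := (1 / 2 : ℝ) • x₀ + (1 / 2 : ℝ) • x with hz
  have hsub : Metric.ball z (r / 2) ⊆ (Metric.closedBall x₀ (N : ℝ))ᶜ := by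
    intro w hw
    simp only [mem_compl_iff, Metric.mem_closedBall, not_le, dist_eq_norm]
    rw [Metric.mem_ball, dist_eq_norm] at hw
    have e1 : x - x₀ = (2 : ℝ) • ((w - x₀) - (w - z)) := by
      rw [hz]; module
    have : ‖x - x₀‖ ≤ 2 * (‖w - x₀‖ + ‖w - z‖) := by
      rw [e1, norm_smul]
      simpa using norm_sub_le (w - x₀) (w - z)
    linarith
  have hle : ∀ w ∈ Metric.ball z (r / 2), c' ≤ ρ w := by
    intro w hw
    have h2 : (2 : ℝ) • w - x ∈ Metric.ball x₀ r := by
      rw [Metric.mem_ball, dist_eq_norm] at hw ⊢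
      have : (2 : ℝ) • w - x - x₀ = (2 : ℝ) • (w - z) := by rw [hz]; module
      rw [this, norm_smul]
      norm_num
      linarith
    have := hρ.convex_superlevel_real h0 c' (x := (2 : ℝ) • w - x) (y := x)
      (hcc.trans (hball _ h2)) hcx (a := 1 / 2) (b := 1 / 2) (by norm_num) (by norm_num)
      (by norm_num)
    have e : (1 / 2 : ℝ) • ((2 : ℝ) • w - x) + (1 / 2 : ℝ) • x = w := by module
    rwa [e] at this
  calc c' * v = ∫ _ in Metric.ball z (r / 2), c' ∂μ := by
        rw [setIntegral_const, smul_eq_mul, mul_comm, hv, measureReal_def, measureReal_def,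
          Measure.addHaar_ball_center μ z]
    _ ≤ ∫ w in Metric.ball z (r / 2), ρ w ∂μ :=
        setIntegral_mono_on (integrableOn_const measure_ball_lt_top.ne) hint.integrableOn
          measurableSet_ball hle
    _ ≤ _ := setIntegral_mono_set hint.integrableOn (ae_of_all _ h0) hsub.eventuallyLE

/-- An integrable log-concave function decays exponentially. -/
theorem LogConcave.exists_exp_decay (hρ : LogConcave fun x => ENNReal.ofReal (ρ x))
    (h0 : ∀ x, 0 ≤ ρ x) (hint : Integrable ρ μ) (hne : ¬ ρ =ᵐ[μ] 0) :
    ∃ c > 0, ∃ x₀, ∃ R > 0, ∀ x, R ≤ ‖x - x₀‖ → ρ x ≤ c * Real.exp (-(‖x - x₀‖ / R)) := by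
  obtain ⟨c, hc, x₀, r, hr, hball⟩ := hρ.exists_ball_le μ h0 hne
  obtain ⟨R, hR, hlt⟩ := hρ.exists_lt_of_le_norm μ h0 hint hr (c' := c * Real.exp (-1))
    (by positivity) (by
      have : Real.exp (-1) ≤ 1 := Real.exp_le_one_iff.2 (by norm_num)
      nlinarith) hball
  refine ⟨c, hc, x₀, R, hR, fun x hx => ?_⟩
  rcases hx.eq_or_lt with hx | hx
  · rw [← hx, div_self hR.ne']
    exact (hlt x hx.le).le
  have hd : 0 < ‖x - x₀‖ := hR.trans hx
  -- This `t` marks the point of the segment at distance `R` from `x₀`, where `ρ < c / e`.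
  -- Log-concavity gives `c ^ (1 - t) * ρ x ^ t ≤ c / e`, that is `ρ x ≤ c * e^{-1/t}`.
  set t := R / ‖x - x₀‖ with ht
  have ht0 : 0 < t := by positivity
  have ht1 : t < 1 := (div_lt_one hd).2 hx
  have h1 := hρ.rpow_mul_rpow_le h0 x₀ x ht0 ht1
  have h2 : ρ ((1 - t) • x₀ + t • x) < c * Real.exp (-1) := by
    refine hlt _ (le_of_eq ?_)
    have : (1 - t) • x₀ + t • x - x₀ = t • (x - x₀) := by module
    rw [this, norm_smul, Real.norm_of_nonneg ht0.le, ht, div_mul_cancel₀ _ hd.ne']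
  have h3 : c ^ (1 - t) * ρ x ^ t ≤ c * Real.exp (-1) := by
    refine le_trans ?_ (h1.trans h2.le)
    gcongr
    · exact Real.rpow_nonneg (h0 x) _
    · exact hball _ (Metric.mem_ball_self hr)
  have h4 : ρ x ^ t ≤ (c * Real.exp (-(‖x - x₀‖ / R))) ^ t := by
    rw [Real.mul_rpow hc.le (Real.exp_pos _).le, ← Real.exp_mul]
    have e : -(‖x - x₀‖ / R) * t = -1 := by rw [ht]; field_simp
    rw [e]
    have : c = c ^ (1 - t) * c ^ t := by
      rw [← Real.rpow_add hc]; simp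
    rw [this, mul_assoc] at h3
    rw [← this] at h3
    exact le_of_mul_le_mul_left h3 (Real.rpow_pos_of_pos hc _)
  exact (Real.rpow_le_rpow_iff (h0 x) (by positivity) ht0).1 h4

theorem integrable_sq_norm_mul_exp_neg_norm_sub (x₀ : E) {R : ℝ} (hR : 0 < R) :
    Integrable (fun x => ‖x‖ ^ 2 * Real.exp (-(‖x - x₀‖ / R))) μ := by
  -- Two powers absorb `‖x‖ ^ 2`; the remaining `finrank + 1` make the bound integrable.
  set N := Module.finrank ℝ E + 3 with hN
  have hdom : Integrable (fun y : E => (1 + ‖y‖) ^ (-((Module.finrank ℝ E : ℝ) + 1))) μ :=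
    integrable_one_add_norm (by linarith)
  have hdom' := ((hdom.comp_sub_right x₀).const_mul
    ((1 + ‖x₀‖) ^ 2 * (Real.exp (1 / R) * (N.factorial * R ^ N))))
  refine hdom'.mono' (by fun_prop) (ae_of_all _ fun x => ?_)
  rw [Real.norm_of_nonneg (by positivity)]
  set s := ‖x - x₀‖
  have hs : 0 ≤ s := norm_nonneg _
  have h1 : ‖x‖ ≤ (1 + ‖x₀‖) * (1 + s) := by
    have : ‖x‖ ≤ s + ‖x₀‖ := by simpa [s] using norm_add_le (x - x₀) x₀
    nlinarith [norm_nonneg x₀, mul_nonneg (norm_nonneg x₀) hs]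
  have h2 : Real.exp (-(s / R)) ≤ Real.exp (1 / R) * (N.factorial * R ^ N) / (1 + s) ^ N := by
    have := Real.pow_div_factorial_le_exp ((1 + s) / R) (by positivity) N
    have e : Real.exp (-(s / R)) = Real.exp (1 / R) / Real.exp ((1 + s) / R) := by
      rw [← Real.exp_sub]; congr 1; field_simp; ring
    rw [e, mul_div_assoc, div_eq_mul_inv]
    gcongr
    rw [inv_le_comm₀ (Real.exp_pos _) (by positivity)]
    refine le_trans (le_of_eq ?_) this
    rw [div_pow]
    field_simp
  calc ‖x‖ ^ 2 * Real.exp (-(s / R))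
      ≤ ((1 + ‖x₀‖) * (1 + s)) ^ 2 *
        (Real.exp (1 / R) * (N.factorial * R ^ N) / (1 + s) ^ N) := by gcongr
    _ = _ := by
      rw [Real.rpow_neg (by positivity), show (Module.finrank ℝ E : ℝ) + 1 =
        ((Module.finrank ℝ E + 1 : ℕ) : ℝ) by push_cast; rfl, Real.rpow_natCast, hN,
        show Module.finrank ℝ E + 3 = Module.finrank ℝ E + 1 + 2 by ring]
      field_simp
      ring

/-- An integrable log-concave function has a finite second moment. -/
theorem LogConcave.integrable_sq_norm_mul (hρ : LogConcave fun x => ENNReal.ofReal (ρ x))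
    (h0 : ∀ x, 0 ≤ ρ x) (hint : Integrable ρ μ) : Integrable (fun x => ‖x‖ ^ 2 * ρ x) μ := by
  by_cases hne : ρ =ᵐ[μ] 0
  · refine (integrable_zero E ℝ μ).congr ?_
    filter_upwards [hne] with x hx
    simp [hx]
  obtain ⟨c, hc, x₀, R, hR, hdec⟩ := hρ.exists_exp_decay μ h0 hint hne
  refine Integrable.mono' ((hint.const_mul ((R + ‖x₀‖) ^ 2)).add
    ((integrable_sq_norm_mul_exp_neg_norm_sub μ x₀ hR).const_mul c))
    (AEStronglyMeasurable.mul (by fun_prop) hint.aestronglyMeasurable) (ae_of_all _ fun x => ?_)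
  rw [Real.norm_of_nonneg (mul_nonneg (by positivity) (h0 x)), Pi.add_apply]
  by_cases hx : R ≤ ‖x - x₀‖
  · have h1 : 0 ≤ (R + ‖x₀‖) ^ 2 * ρ x := mul_nonneg (by positivity) (h0 x)
    have h2 := mul_le_mul_of_nonneg_left (hdec x hx) (sq_nonneg ‖x‖)
    linarith
  · have h1 : ‖x‖ ≤ R + ‖x₀‖ := by
      have : ‖x‖ ≤ ‖x - x₀‖ + ‖x₀‖ := by simpa using norm_add_le (x - x₀) x₀
      linarith
    have h2 : ‖x‖ ^ 2 * ρ x ≤ (R + ‖x₀‖) ^ 2 * ρ x :=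
      mul_le_mul_of_nonneg_right (by gcongr) (h0 x)
    have : 0 ≤ c * (‖x‖ ^ 2 * Real.exp (-(‖x - x₀‖ / R))) := by positivity
    linarith

end FiniteDim

/-! ### Quadratic polynomials adapted to an interval. -/

/-- An order-connected subset of the line is, up to null sets, the region of negativity of a
convex quadratic polynomial. -/
theorem Set.OrdConnected.exists_quadratic {S : Set ℝ} (hS : S.OrdConnected) :
    ∃ A B C : ℝ, 0 ≤ A ∧ (∀ s ∈ S, A * s ^ 2 + B * s + C ≤ 0) ∧
      (∀ s ∉ S, 0 ≤ A * s ^ 2 + B * s + C) ∧ ∀ᵐ s : ℝ, A * s ^ 2 + B * s + C ≠ 0 := by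
  have hne : ∀ a : ℝ, ∀ᵐ s : ℝ, s ≠ a := fun a => by simp [ae_iff]
  rcases S.eq_empty_or_nonempty with rfl | hne'
  · exact ⟨0, 0, 1, le_rfl, by simp, by simp, by simp⟩
  by_cases hb : BddBelow S <;> by_cases ha : BddAbove S
  -- The polynomial is `(s - sInf S) * (s - sSup S)`; an infinite end drops its factor, leaving an
  -- affine function or the constant `-1`.
  · refine ⟨1, -(sInf S + sSup S), sInf S * sSup S, zero_le_one, fun s hs => ?_, fun s hs => ?_, ?_⟩
    · nlinarith [mul_nonneg (sub_nonneg.2 (csInf_le hb hs)) (sub_nonneg.2 (le_csSup ha hs))]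
    · have : s ≤ sInf S ∨ sSup S ≤ s := by
        by_contra! h
        obtain ⟨a, ha', has⟩ := exists_lt_of_csInf_lt hne' h.1
        obtain ⟨b, hb', hbs⟩ := exists_lt_of_lt_csSup hne' h.2
        exact hs (hS.out ha' hb' ⟨has.le, hbs.le⟩)
      have h3 : sInf S ≤ sSup S := csInf_le_csSup hne' hb ha
      rcases this with h | h
      · nlinarith [mul_nonneg (sub_nonneg.2 h) (sub_nonneg.2 (h.trans h3))]
      · nlinarith [mul_nonneg (sub_nonneg.2 h) (sub_nonneg.2 (h3.trans h))]
    · filter_upwards [hne (sInf S), hne (sSup S)] with s h1 h2 h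
      have : (s - sInf S) * (s - sSup S) = 0 := by linarith
      rcases mul_eq_zero.1 this with h | h
      · exact h1 (sub_eq_zero.1 h)
      · exact h2 (sub_eq_zero.1 h)
  · refine ⟨0, -1, sInf S, le_rfl, fun s hs => ?_, fun s hs => ?_, ?_⟩
    · linarith [csInf_le hb hs]
    · by_contra! h
      obtain ⟨a, ha', has⟩ := exists_lt_of_csInf_lt hne' (show sInf S < s by linarith)
      obtain ⟨b, hb', hbs⟩ := not_bddAbove_iff.1 ha s
      exact hs (hS.out ha' hb' ⟨has.le, hbs.le⟩)
    · filter_upwards [hne (sInf S)] with s h1 h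
      exact h1 (by linarith)
  · refine ⟨0, 1, -sSup S, le_rfl, fun s hs => ?_, fun s hs => ?_, ?_⟩
    · linarith [le_csSup ha hs]
    · by_contra! h
      obtain ⟨a, ha', has⟩ := not_bddBelow_iff.1 hb s
      obtain ⟨b, hb', hbs⟩ := exists_lt_of_lt_csSup hne' (show s < sSup S by linarith)
      exact hs (hS.out ha' hb' ⟨has.le, hbs.le⟩)
    · filter_upwards [hne (sSup S)] with s h1 h
      exact h1 (by linarith)
  · refine ⟨0, 0, -1, le_rfl, by simp, fun s hs => ?_, by simp⟩
    obtain ⟨a, ha', has⟩ := not_bddBelow_iff.1 hb s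
    obtain ⟨b, hb', hbs⟩ := not_bddAbove_iff.1 ha s
    exact (hs (hS.out ha' hb' ⟨has.le, hbs.le⟩)).elim

/-! ### Gaussian weights -/

section Gaussian

variable {δ : ℝ}

theorem sq_mul_exp_neg_le (hδ : 0 < δ) (s : ℝ) :
    s ^ 2 * Real.exp (-(δ * s ^ 2 / 2)) ≤ 2 / δ := by
  have h := Real.add_one_le_exp (δ * s ^ 2 / 2)
  rw [Real.exp_neg, ← div_eq_mul_inv, div_le_div_iff₀ (Real.exp_pos _) hδ]
  nlinarith

theorem exp_neg_mul_sq_le_one (hδ : 0 ≤ δ) (s : ℝ) : Real.exp (-(δ * s ^ 2 / 2)) ≤ 1 :=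
  Real.exp_le_one_iff.2 (by have := sq_nonneg s; nlinarith [mul_nonneg hδ this])

theorem abs_mul_exp_neg_le (hδ : 0 < δ) (s : ℝ) :
    |s| * Real.exp (-(δ * s ^ 2 / 2)) ≤ 1 + 2 / δ := by
  have h1 := sq_mul_exp_neg_le hδ s
  have h2 := exp_neg_mul_sq_le_one hδ.le s
  have h3 : |s| ≤ 1 + s ^ 2 := by
    rw [← sq_abs s]; nlinarith [sq_nonneg (|s| - 1), abs_nonneg s]
  nlinarith [mul_le_mul_of_nonneg_right h3 (Real.exp_pos (-(δ * s ^ 2 / 2))).le]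

theorem abs_pow_mul_exp_neg_le (hδ : 0 < δ) {k : ℕ} (hk : k ≤ 2) (s : ℝ) :
    |s ^ k * Real.exp (-(δ * s ^ 2 / 2))| ≤ 1 + 2 / δ := by
  have h0 : 0 < 2 / δ := by positivity
  rw [abs_mul, abs_pow, abs_of_pos (Real.exp_pos _)]
  interval_cases k
  · have := exp_neg_mul_sq_le_one hδ.le s
    simpa using this.trans (by linarith)
  · simpa using abs_mul_exp_neg_le hδ s
  · rw [sq_abs]
    linarith [sq_mul_exp_neg_le hδ s]

theorem integrable_exp_neg_mul_sq_half (hδ : 0 < δ) :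
    Integrable fun s : ℝ => Real.exp (-(δ * s ^ 2 / 2)) := by
  convert integrable_exp_neg_mul_sq (half_pos hδ) using 3
  ring

theorem integrable_pow_mul_exp_neg (hδ : 0 < δ) (k : ℕ) :
    Integrable fun s : ℝ => s ^ k * Real.exp (-(δ * s ^ 2 / 2)) := by
  convert integrable_rpow_mul_exp_neg_mul_sq (half_pos hδ) (s := k)
    (lt_of_lt_of_le (by norm_num) k.cast_nonneg) using 3
  · rw [Real.rpow_natCast]
  · congr 1; ring

theorem integral_mul_exp_neg_mul_sq : ∫ s : ℝ, s * Real.exp (-(δ * s ^ 2 / 2)) = 0 := by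
  have h := integral_neg_eq_self (fun s : ℝ => s * Real.exp (-(δ * s ^ 2 / 2))) volume
  simp only [neg_sq, neg_mul] at h
  rw [integral_neg] at h
  linarith

/-- The difference of the two sides is the integral of the derivative of `s * e^{-δs²/2}`, which
vanishes. -/
theorem integral_sq_mul_exp_neg_mul_sq (hδ : 0 < δ) :
    δ * ∫ s : ℝ, s ^ 2 * Real.exp (-(δ * s ^ 2 / 2)) = ∫ s : ℝ, Real.exp (-(δ * s ^ 2 / 2)) := by
  have hd : ∀ s : ℝ, HasDerivAt (fun s : ℝ => s * Real.exp (-(δ * s ^ 2 / 2)))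
      (Real.exp (-(δ * s ^ 2 / 2)) - δ * (s ^ 2 * Real.exp (-(δ * s ^ 2 / 2)))) s := by
    intro s
    have h1 : HasDerivAt (fun s : ℝ => -(δ * s ^ 2 / 2)) (-(δ * s)) s := by
      have := (((hasDerivAt_pow 2 s).const_mul δ).div_const 2).neg
      convert! this using 1
      norm_num
      ring
    have := (hasDerivAt_id s).mul h1.exp
    convert! this using 1
    simp only [id]
    ring
  have hi := (integrable_exp_neg_mul_sq_half hδ).sub
    ((integrable_pow_mul_exp_neg hδ 2).const_mul δ)
  have := integral_eq_zero_of_hasDerivAt_of_integrable hd hi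
    (by simpa using integrable_pow_mul_exp_neg hδ 1)
  rw [integral_sub (integrable_exp_neg_mul_sq_half hδ)
    ((integrable_pow_mul_exp_neg hδ 2).const_mul δ), integral_const_mul] at this
  linarith

end Gaussian

/-! ### The one-dimensional variance comparison. -/

theorem MeasureTheory.integral_linComb {α : Type*} [MeasurableSpace α] {μ : Measure α}
    {f₁ f₂ f₃ f₄ : α → ℝ} (h₁ : Integrable f₁ μ) (h₂ : Integrable f₂ μ) (h₃ : Integrable f₃ μ)
    (h₄ : Integrable f₄ μ) (a b c d : ℝ) {f : α → ℝ}
    (hf : ∀ x, f x = a * f₁ x + b * f₂ x + c * f₃ x + d * f₄ x) :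
    Integrable f μ ∧ ∫ x, f x ∂μ =
      a * (∫ x, f₁ x ∂μ) + b * (∫ x, f₂ x ∂μ) + c * (∫ x, f₃ x ∂μ) + d * ∫ x, f₄ x ∂μ := by
  have e₂ := (h₁.const_mul a).add (h₂.const_mul b)
  have e₃ := e₂.add (h₃.const_mul c)
  have e₄ := e₃.add (h₄.const_mul d)
  refine ⟨e₄.congr (ae_of_all _ fun x => (hf x).symm), ?_⟩
  rw [← integral_const_mul, ← integral_const_mul, ← integral_const_mul, ← integral_const_mul,
    ← integral_add (h₁.const_mul a) (h₂.const_mul b)]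
  erw [← integral_add e₂ (h₃.const_mul c), ← integral_add e₃ (h₄.const_mul d)]
  exact integral_congr_ae (ae_of_all _ hf)

/-- Adding the reflected function gives an integrable function bounded below by 1. This excludes the
equality case of the variance bound. -/
theorem not_integrable_exp_mul (c : ℝ) : ¬ Integrable fun s : ℝ => Real.exp (c * s) := by
  intro h
  have h2 := h.add h.comp_neg
  have h3 : Integrable fun _ : ℝ => (1 : ℝ) := by
    refine h2.mono' (by fun_prop) (ae_of_all _ fun s => ?_)
    simp only [Pi.add_apply, norm_one]
    rcases le_total 0 (c * s) with hs | hs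
    · linarith [Real.one_le_exp hs, Real.exp_pos (c * -s)]
    · linarith [Real.one_le_exp (show 0 ≤ c * -s by linarith), Real.exp_pos (c * s)]
  simp [integrable_const_iff, isFiniteMeasure_iff] at h3

/-- A density which is the product of a centred Gaussian of variance `1/δ` and of an integrable
log-concave function has variance less than `1/δ`. -/
theorem LogConcave.variance_lt {H : ℝ → ℝ≥0∞} (hH : LogConcave H) {h : ℝ → ℝ}
    (hint : Integrable h) (h0 : ∀ s, 0 ≤ h s) (hHh : ∀ᵐ s, H s = ENNReal.ofReal (h s)) {δ : ℝ}
    (hδ : 0 < δ) (hpos : 0 < ∫ s, Real.exp (-(δ * s ^ 2 / 2)) * h s) :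
    δ * ((∫ s, Real.exp (-(δ * s ^ 2 / 2)) * h s) *
        (∫ s, s ^ 2 * (Real.exp (-(δ * s ^ 2 / 2)) * h s)) -
      (∫ s, s * (Real.exp (-(δ * s ^ 2 / 2)) * h s)) ^ 2) <
    (∫ s, Real.exp (-(δ * s ^ 2 / 2)) * h s) ^ 2 := by
  set G : ℝ → ℝ := fun s => Real.exp (-(δ * s ^ 2 / 2)) with hG
  change 0 < ∫ s, G s * h s at hpos
  change δ * ((∫ s, G s * h s) * (∫ s, s ^ 2 * (G s * h s)) - (∫ s, s * (G s * h s)) ^ 2) <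
    (∫ s, G s * h s) ^ 2
  have i : ∀ k ≤ 2, Integrable fun s => s ^ k * (G s * h s) := by
    intro k hk
    have : Integrable fun s => (s ^ k * G s) * h s :=
      hint.bdd_mul (c := 1 + 2 / δ) (by fun_prop) (ae_of_all _ fun s => abs_pow_mul_exp_neg_le hδ hk s)
    simpa only [mul_assoc] using this
  have i0 : Integrable fun s => G s * h s := by simpa using i 0 (by norm_num)
  have i1 : Integrable fun s => s * (G s * h s) := by simpa using i 1 (by norm_num)
  have i2 : Integrable fun s => s ^ 2 * (G s * h s) := i 2 le_rfl
  set p0 := ∫ s, G s * h s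
  set p1 := ∫ s, s * (G s * h s)
  set p2 := ∫ s, s ^ 2 * (G s * h s)
  set a := p1 / p0 with ha
  have hap : a * p0 = p1 := div_mul_cancel₀ _ hpos.ne'
  -- moments of the translated Gaussian
  have g0 : Integrable G := integrable_exp_neg_mul_sq_half hδ
  have g1 : Integrable fun s => s * G s := by simpa using integrable_pow_mul_exp_neg hδ 1
  have g2 : Integrable fun s => s ^ 2 * G s := integrable_pow_mul_exp_neg hδ 2
  have j0 : Integrable fun s => G (s - a) := g0.comp_sub_right a
  have j1 : Integrable fun s => (s - a) * G (s - a) := g1.comp_sub_right a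
  have j2 : Integrable fun s => (s - a) ^ 2 * G (s - a) := g2.comp_sub_right a
  set Z := ∫ s, G s with hZ
  have hZpos : 0 < Z := by
    have : Z = √(Real.pi / (δ / 2)) := by
      rw [hZ, ← integral_gaussian]; congr 1; ext s; rw [hG]; ring_nf
    rw [this]
    positivity
  have J0 : ∫ s, G (s - a) = Z := integral_sub_right_eq_self G a
  have J1 : ∫ s, (s - a) * G (s - a) = 0 := by
    rw [integral_sub_right_eq_self (fun s => s * G s) a]; exact integral_mul_exp_neg_mul_sq
  have J2 : δ * ∫ s, (s - a) ^ 2 * G (s - a) = Z := by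
    rw [integral_sub_right_eq_self (fun s => s ^ 2 * G s) a]
    exact integral_sq_mul_exp_neg_mul_sq hδ
  -- The multiple `l` and the centre `a` give the comparison Gaussian the mass and mean of `G * h`,
  -- so the difference `P` has vanishing moments of orders 0 and 1.
  set l := p0 / Z with hl
  have hlpos : 0 < l := by positivity
  have hlZ : l * Z = p0 := div_mul_cancel₀ _ hZpos.ne'
  set P : ℝ → ℝ := fun s => G s * h s - l * G (s - a) with hP
  have q0 : Integrable P := i0.sub (j0.const_mul l)
  obtain ⟨q1, Q1⟩ := integral_linComb i1 i0 j1 j0 1 (-a) (-l) 0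
    (f := fun s => (s - a) * P s) (fun s => by simp only [hP]; ring)
  obtain ⟨q2, Q2⟩ := integral_linComb i2 i1 i0 j2 1 (-(2 * a)) (a ^ 2) (-l)
    (f := fun s => (s - a) ^ 2 * P s) (fun s => by simp only [hP]; ring)
  have Q0 : ∫ s, P s = 0 := by
    rw [hP, integral_sub i0 (j0.const_mul l), integral_const_mul, J0, hlZ]; exact sub_self _
  replace Q1 : ∫ s, (s - a) * P s = 0 := by
    rw [Q1, J1]; linear_combination -hap
  -- the comparison of the log-concave factor with a constant
  set w : ℝ → ℝ := fun s => Real.exp (-(δ * a * s - δ * a ^ 2 / 2)) with hw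
  have hGw : ∀ s, G s = G (s - a) * w s := fun s => by
    simp only [hG, hw, ← Real.exp_add]; congr 1; ring
  -- Recentring the Gaussian costs the log-affine factor `w`, so `w * h` is still log-concave almost
  -- everywhere and `P ≥ 0` on an interval, up to a null set.
  have hPw : ∀ s, P s = G (s - a) * (w s * h s - l) := fun s => by
    simp only [hP]; rw [hGw s]; ring
  have hK : LogConcave fun s => ENNReal.ofReal (w s) * H s := by
    refine LogConcave.mul ?_ hH
    refine ConvexOn.logConcave_exp_neg (φ := fun s => δ * a * s - δ * a ^ 2 / 2)
      ⟨convex_univ, fun x _ y _ b c _ _ hbc => le_of_eq ?_⟩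
    simp only [smul_eq_mul]
    linear_combination (δ * a ^ 2 / 2) * hbc
  obtain ⟨A, B, C, hA, hneg, hnonneg, hne⟩ :=
    (hK.convex_superlevel (ENNReal.ofReal l)).ordConnected.exists_quadratic
  have hsign : ∀ᵐ s, (A * s ^ 2 + B * s + C) * P s ≤ 0 := by
    filter_upwards [hHh] with s hs
    have hmem : s ∈ {s | ENNReal.ofReal l ≤ ENNReal.ofReal (w s) * H s} ↔ l ≤ w s * h s := by
      rw [mem_ofPred_eq, hs, ← ENNReal.ofReal_mul (Real.exp_pos _).le,
        ENNReal.ofReal_le_ofReal_iff (mul_nonneg (Real.exp_pos _).le (h0 s))]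
    have hGpos : 0 < G (s - a) := Real.exp_pos _
    rw [hPw]
    by_cases hls : l ≤ w s * h s
    · exact mul_nonpos_of_nonpos_of_nonneg (hneg s (hmem.2 hls))
        (mul_nonneg hGpos.le (sub_nonneg.2 hls))
    · exact mul_nonpos_of_nonneg_of_nonpos (hnonneg s (fun h => hls (hmem.1 h)))
        (mul_nonpos_of_nonneg_of_nonpos hGpos.le (by linarith))
  -- The quadratic is re-expanded in powers of `s - a`; only its leading term survives integration
  -- against `P`.
  obtain ⟨hqi, hqI⟩ := integral_linComb q2 q1 q0 q0 A (2 * a * A + B) (A * a ^ 2 + B * a + C) 0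
    (f := fun s => (A * s ^ 2 + B * s + C) * P s) (fun s => by ring)
  rw [Q0, Q1, mul_zero, mul_zero, mul_zero, add_zero, add_zero, add_zero] at hqI
  -- Equality would force `P = 0` almost everywhere, making `h` a multiple of an exponential, which
  -- is not integrable.
  have hqne : ∫ s, (A * s ^ 2 + B * s + C) * P s ≠ 0 := by
    intro hz
    have h1 : ∫ s, (-fun s => (A * s ^ 2 + B * s + C) * P s) s = 0 := by
      simp only [Pi.neg_apply]; rw [integral_neg, hz, neg_zero]
    rw [integral_eq_zero_iff_of_nonneg_ae (by
      filter_upwards [hsign] with s hs; simpa using hs) hqi.neg] at h1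
    have h2 : ∀ᵐ s, Real.exp ((-(δ * a)) * s) * Real.exp (δ * a ^ 2 / 2) * h s = l := by
      filter_upwards [h1, hne] with s hs hs'
      simp only [Pi.neg_apply, Pi.zero_apply, neg_eq_zero, mul_eq_zero, hs', false_or, hPw] at hs
      have := sub_eq_zero.1 (hs.resolve_left (Real.exp_pos _).ne')
      rw [← this, hw, ← Real.exp_add]
      congr 2; ring
    refine not_integrable_exp_mul (δ * a) ?_
    refine (hint.const_mul (Real.exp (δ * a ^ 2 / 2) / l)).congr ?_
    filter_upwards [h2] with s hs
    have e : Real.exp (-(δ * a) * s) * Real.exp (δ * a * s) = 1 := by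
      rw [← Real.exp_add]; simp
    have : Real.exp (δ * a ^ 2 / 2) * h s = l * Real.exp (δ * a * s) := by
      rw [← hs]
      linear_combination (-(Real.exp (δ * a ^ 2 / 2) * h s)) * e
    rw [div_mul_eq_mul_div, this, mul_div_cancel_left₀ _ hlpos.ne']
  have hlt : A * ∫ s, (s - a) ^ 2 * P s < 0 := by
    rw [← hqI]
    refine lt_of_le_of_ne ?_ hqne
    exact integral_nonpos_of_ae hsign
  have hD : ∫ s, (s - a) ^ 2 * P s < 0 := by
    by_contra! h
    exact absurd hlt (not_lt.2 (mul_nonneg hA h))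
  rw [Q2] at hD
  have h3 : δ * (p2 - 2 * a * p1 + a ^ 2 * p0) < p0 := by
    have := mul_lt_mul_of_pos_left hD hδ
    have e : δ * (l * ∫ s, (s - a) ^ 2 * G (s - a)) = p0 := by rw [← hlZ, ← J2]; ring
    linear_combination this + e
  have h4 := mul_lt_mul_of_pos_right h3 hpos
  calc δ * (p0 * p2 - p1 ^ 2) = δ * (p2 - 2 * a * p1 + a ^ 2 * p0) * p0 := by
        rw [← hap]; ring
    _ < p0 * p0 := h4
    _ = p0 ^ 2 := by ring

/-! ### Directional variances in `ℝⁿ`, by reduction to a marginal on the line. -/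

/-- An orthonormal coordinate system of `ℝᵏ⁺¹` centred at `m` whose first axis is spanned by
a given unit vector. -/
theorem exists_measurableEquiv_prod {k : ℕ} (m : EuclideanSpace ℝ (Fin (k + 1)))
    {u : EuclideanSpace ℝ (Fin (k + 1))} (hu : ‖u‖ = 1) :
    ∃ T : ℝ × (Fin k → ℝ) ≃ᵐ EuclideanSpace ℝ (Fin (k + 1)), MeasurePreserving T ∧
      (∃ L : ℝ × (Fin k → ℝ) →ₗ[ℝ] EuclideanSpace ℝ (Fin (k + 1)), ∀ p, T p = m + L p) ∧
      (∀ p, ‖T p - m‖ ^ 2 = p.1 ^ 2 + ∑ i, p.2 i ^ 2) ∧ ∀ p, ⟪T p - m, u⟫_ℝ = p.1 := by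
  have hon : Orthonormal ℝ (({0} : Set (Fin (k + 1))).domRestrict fun _ => u) := by
    constructor
    · rintro ⟨i, hi⟩; exact hu
    · rintro ⟨i, hi⟩ ⟨j, hj⟩ hij
      rw [mem_singleton_iff] at hi hj
      exact (hij (by simp [hi, hj])).elim
  obtain ⟨b, hb⟩ := hon.exists_orthonormalBasis_extension_of_card_eq
    (by simp : Module.finrank ℝ (EuclideanSpace ℝ (Fin (k + 1))) = Fintype.card (Fin (k + 1)))
  replace hb : b 0 = u := hb 0 rfl
  let e := MeasurableEquiv.piFinSuccAbove (fun _ : Fin (k + 1) => ℝ) 0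
  have he : MeasurePreserving e.symm :=
    (volume_preserving_piFinSuccAbove (fun _ : Fin (k + 1) => ℝ) 0).symm
  have hcons : ∀ p : ℝ × (Fin k → ℝ), e.symm p = Fin.cons p.1 p.2 := by
    intro p
    simp [e, MeasurableEquiv.piFinSuccAbove, Fin.insertNthEquiv]
  let T : ℝ × (Fin k → ℝ) ≃ᵐ EuclideanSpace ℝ (Fin (k + 1)) :=
    ((e.symm.trans (MeasurableEquiv.toLp 2 (Fin (k + 1) → ℝ))).trans
      b.measurableEquiv.symm).trans (MeasurableEquiv.addLeft m)
  have hT : ∀ p, T p = m + b.repr.symm (WithLp.toLp 2 (Fin.cons p.1 p.2 : Fin (k + 1) → ℝ)) := by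
    intro p
    rw [← hcons]
    rfl
  refine ⟨T, ?_, ?_, ?_, ?_⟩
  · exact (measurePreserving_add_left volume m).comp ((b.measurePreserving_repr_symm).comp
      ((PiLp.volume_preserving_toLp (Fin (k + 1))).comp he))
  · refine ⟨⟨⟨fun p => b.repr.symm (WithLp.toLp 2 (Fin.cons p.1 p.2 : Fin (k + 1) → ℝ)), ?_⟩, ?_⟩,
      hT⟩
    · intro p q
      rw [← map_add, ← WithLp.toLp_add]
      congr 2
      ext i
      refine Fin.cases ?_ (fun j => ?_) i <;> simp
    · intro c p
      simp only [RingHom.id_apply]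
      rw [← LinearIsometryEquiv.map_smul, ← WithLp.toLp_smul]
      congr 2
      ext i
      refine Fin.cases ?_ (fun j => ?_) i <;> simp
  · intro p
    rw [hT, add_sub_cancel_left, LinearIsometryEquiv.norm_map, EuclideanSpace.norm_sq_eq,
      Fin.sum_univ_succ]
    simp
  · intro p
    rw [hT, add_sub_cancel_left, ← hb, real_inner_comm, ← b.repr_apply_apply]
    simp

theorem LogConcave.const_add {E : Type*} [AddCommGroup E] [Module ℝ E] {f : E → ℝ≥0∞}
    (hf : LogConcave f) (m : E) : LogConcave fun x => f (m + x) := fun x y t ht ht' => by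
  have := hf (x := m + x) (y := m + y) ht ht'
  rwa [show (1 - t) • (m + x) + t • (m + y) = m + ((1 - t) • x + t • y) by module] at this

/-- Under a density proportional to `e^{-δ|x-m|²/2} ρ(x)` with `ρ` log-concave and integrable, the
variance of a linear functional `⟪·, u⟫` is less than `1/δ`. -/
theorem LogConcave.tilt_variance_lt_of_unit {k : ℕ} {ρ : EuclideanSpace ℝ (Fin (k + 1)) → ℝ}
    (hρ : LogConcave fun x => ENNReal.ofReal (ρ x)) (hm : Measurable ρ) (h0 : ∀ x, 0 ≤ ρ x)
    (hint : Integrable ρ) {δ : ℝ} (hδ : 0 < δ) (m : EuclideanSpace ℝ (Fin (k + 1)))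
    (hpos : 0 < ∫ x, tilt ρ δ m x) {u : EuclideanSpace ℝ (Fin (k + 1))} (hu : ‖u‖ = 1) :
    δ * ((∫ x, tilt ρ δ m x) * (∫ x, ⟪x - m, u⟫_ℝ ^ 2 * tilt ρ δ m x) -
      (∫ x, ⟪x - m, u⟫_ℝ * tilt ρ δ m x) ^ 2) < (∫ x, tilt ρ δ m x) ^ 2 := by
  obtain ⟨T, hT, ⟨L, hL⟩, hnorm, hinner⟩ := exists_measurableEquiv_prod m hu
  -- The Gaussian factor orthogonal to `u` is absorbed into `w`; the factor along `u` stays outside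
  -- and becomes the Gaussian of the one-dimensional lemma.
  set w : ℝ × (Fin k → ℝ) → ℝ :=
    fun p => Real.exp (-(δ * (∑ i, p.2 i ^ 2) / 2)) * ρ (T p) with hw
  have hwm : Measurable w := (by fun_prop : Measurable fun p : ℝ × (Fin k → ℝ) =>
    Real.exp (-(δ * (∑ i, p.2 i ^ 2) / 2))).mul (hm.comp T.measurable)
  have hw0 : ∀ p, 0 ≤ w p := fun p => mul_nonneg (Real.exp_pos _).le (h0 _)
  have hwi : Integrable w := by
    have h1 : Integrable fun p => ρ (T p) := (hT.integrable_comp_emb T.measurableEmbedding).2 hint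
    refine h1.bdd_mul (c := 1) (by fun_prop) (ae_of_all _ fun p => ?_)
    rw [Real.norm_of_nonneg (Real.exp_pos _).le]
    refine Real.exp_le_one_iff.2 ?_
    have : 0 ≤ ∑ i, p.2 i ^ 2 := Finset.sum_nonneg fun i _ => sq_nonneg _
    nlinarith [mul_nonneg hδ.le this]
  have hwi' : Integrable w (volume.prod volume) := hwi
  have htilt : ∀ p, tilt ρ δ m (T p) = Real.exp (-(δ * p.1 ^ 2 / 2)) * w p := by
    intro p
    rw [tilt, hnorm, hw, ← mul_assoc, ← Real.exp_add]
    congr 2; ring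
  have hLC : LogConcave fun p => ENNReal.ofReal (w p) := by
    have h1 : LogConcave fun p : ℝ × (Fin k → ℝ) =>
        ENNReal.ofReal (Real.exp (-(δ * (∑ i, p.2 i ^ 2) / 2))) := by
      refine ConvexOn.logConcave_exp_neg (φ := fun p : ℝ × (Fin k → ℝ) => δ * (∑ i, p.2 i ^ 2) / 2)
        ⟨convex_univ, fun p _ q _ a b ha hb hab => ?_⟩
      simp only [Prod.snd_add, Prod.smul_snd, Pi.add_apply, Pi.smul_apply, smul_eq_mul]
      have : ∑ i, (a * p.2 i + b * q.2 i) ^ 2 ≤ a * ∑ i, p.2 i ^ 2 + b * ∑ i, q.2 i ^ 2 := by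
        rw [Finset.mul_sum, Finset.mul_sum, ← Finset.sum_add_distrib]
        refine Finset.sum_le_sum fun i _ => ?_
        obtain rfl : b = 1 - a := by linarith
        nlinarith [mul_nonneg (mul_nonneg ha hb) (sq_nonneg (p.2 i - q.2 i))]
      nlinarith [mul_le_mul_of_nonneg_left this hδ.le]
    have h2 : LogConcave fun p => ENNReal.ofReal (ρ (T p)) := by
      simp only [hL]
      exact (hρ.const_add m).comp_linearMap L
    have h3 : ∀ p, ENNReal.ofReal (w p) =
        ENNReal.ofReal (Real.exp (-(δ * (∑ i, p.2 i ^ 2) / 2))) * ENNReal.ofReal (ρ (T p)) :=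
      fun p => ENNReal.ofReal_mul (Real.exp_pos _).le
    simp only [h3]
    exact h1.mul h2
  have hH := LogConcave.lintegral_pi k hLC
    fun s => ENNReal.measurable_ofReal.comp (hwm.comp measurable_prodMk_left)
  -- The extended marginal is log-concave everywhere but could be infinite on a null set, where the
  -- Bochner integral takes its default value 0.
  have hHh : ∀ᵐ s, ∫⁻ y, ENNReal.ofReal (w (s, y)) = ENNReal.ofReal (∫ y, w (s, y)) := by
    filter_upwards [hwi'.prod_right_ae] with s hs
    exact (ofReal_integral_eq_lintegral_ofReal hs (ae_of_all _ fun y => hw0 _)).symm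
  have key : ∀ j ≤ 2, ∫ x, ⟪x - m, u⟫_ℝ ^ j * tilt ρ δ m x =
      ∫ s, s ^ j * (Real.exp (-(δ * s ^ 2 / 2)) * ∫ y, w (s, y)) := by
    intro j hj
    have h1 : Integrable (fun p : ℝ × (Fin k → ℝ) =>
        (p.1 ^ j * Real.exp (-(δ * p.1 ^ 2 / 2))) * w p) (volume.prod volume) :=
      hwi'.bdd_mul (c := 1 + 2 / δ) (by fun_prop)
        (ae_of_all _ fun p => abs_pow_mul_exp_neg_le hδ hj p.1)
    calc ∫ x, ⟪x - m, u⟫_ℝ ^ j * tilt ρ δ m x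
        = ∫ p, ⟪T p - m, u⟫_ℝ ^ j * tilt ρ δ m (T p) := (hT.integral_comp' _).symm
      _ = ∫ p : ℝ × (Fin k → ℝ), (p.1 ^ j * Real.exp (-(δ * p.1 ^ 2 / 2))) * w p := by
          simp only [hinner, htilt, mul_assoc]
      _ = ∫ s, ∫ y, (s ^ j * Real.exp (-(δ * s ^ 2 / 2))) * w (s, y) := integral_prod _ h1
      _ = _ := by simp only [integral_const_mul, mul_assoc]
  have k0 := key 0 (by norm_num)
  have k1 := key 1 (by norm_num)
  have k2 := key 2 le_rfl
  simp only [pow_zero, one_mul, pow_one] at k0 k1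
  rw [k0, k1, k2]
  rw [k0] at hpos
  exact hH.variance_lt hwi'.integral_prod_left (fun s => integral_nonneg fun y => hw0 _) hHh hδ hpos

theorem LogConcave.tilt_variance_lt {n : ℕ} {ρ : EuclideanSpace ℝ (Fin n) → ℝ}
    (hρ : LogConcave fun x => ENNReal.ofReal (ρ x)) (h0 : ∀ x, 0 ≤ ρ x)
    (hint : Integrable ρ) {δ : ℝ} (hδ : 0 < δ) (m : EuclideanSpace ℝ (Fin n))
    (hpos : 0 < ∫ x, tilt ρ δ m x) {e : EuclideanSpace ℝ (Fin n)} (he : e ≠ 0) :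
    δ * ((∫ x, tilt ρ δ m x) * (∫ x, ⟪x - m, e⟫_ℝ ^ 2 * tilt ρ δ m x) -
      (∫ x, ⟪x - m, e⟫_ℝ * tilt ρ δ m x) ^ 2) < ‖e‖ ^ 2 * (∫ x, tilt ρ δ m x) ^ 2 := by
  obtain ⟨ρ', hm', h0', hρ', hae⟩ := hρ.exists_measurable_ae_eq volume h0
  have ht : ∀ᵐ x, tilt ρ δ m x = tilt ρ' δ m x := by
    filter_upwards [hae] with x hx
    rw [tilt, tilt, hx]
  have e0 : ∫ x, tilt ρ δ m x = ∫ x, tilt ρ' δ m x := integral_congr_ae ht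
  have e1 : ∫ x, ⟪x - m, e⟫_ℝ * tilt ρ δ m x = ∫ x, ⟪x - m, e⟫_ℝ * tilt ρ' δ m x :=
    integral_congr_ae (by filter_upwards [ht] with x hx; rw [hx])
  have e2 : ∫ x, ⟪x - m, e⟫_ℝ ^ 2 * tilt ρ δ m x = ∫ x, ⟪x - m, e⟫_ℝ ^ 2 * tilt ρ' δ m x :=
    integral_congr_ae (by filter_upwards [ht] with x hx; rw [hx])
  rw [e0] at hpos
  rw [e0, e1, e2]
  cases n with
  | zero => exact (he (Subsingleton.elim _ _)).elim
  | succ k =>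
    have hn : 0 < ‖e‖ := norm_pos_iff.2 he
    have := hρ'.tilt_variance_lt_of_unit hm' h0' (hint.congr hae.symm) hδ m hpos
      (u := ‖e‖⁻¹ • e) (by rw [norm_smul, norm_inv, norm_norm, inv_mul_cancel₀ hn.ne'])
    simp only [inner_smul_right, mul_pow, mul_assoc, integral_const_mul] at this
    have h2 := mul_lt_mul_of_pos_left this (pow_pos hn 2)
    convert! h2 using 1
    field_simp

/-! ### Differentiation of `(δ, m) ↦ ∫ ρ(x) G(δ, x - m) dμ(x)`. -/

set_option linter.unusedSectionVars false

section ParametricIntegral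

variable {E W : Type*} [NormedAddCommGroup E] [NormedSpace ℝ E] [FiniteDimensional ℝ E]
  [MeasurableSpace E] [BorelSpace E] [NormedAddCommGroup W] [NormedSpace ℝ W]
  [FiniteDimensional ℝ W] {μ : Measure E} {ρ : E → ℝ} {G : ℝ × E → W} {a b C : ℝ}

/-- The derivative of `p ↦ ∫ ρ(x) G(p.1, x - p.2) dμ(x)`. -/
noncomputable def fderivIntegralSub (μ : Measure E) (ρ : E → ℝ) (G : ℝ × E → W) (p : ℝ × E) :
    ℝ × E →L[ℝ] W :=
  ∫ x, ρ x • (fderiv ℝ G (p.1, x - p.2)).comp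
    ((ContinuousLinearMap.fst ℝ ℝ E).prod (-ContinuousLinearMap.snd ℝ ℝ E)) ∂μ

theorem norm_fst_prod_neg_snd_le :
    ‖(ContinuousLinearMap.fst ℝ ℝ E).prod (-ContinuousLinearMap.snd ℝ ℝ E)‖ ≤ 1 :=
  ContinuousLinearMap.opNorm_le_bound _ zero_le_one fun v => by
    simp [Prod.norm_def]

theorem norm_smul_comp_fst_prod_neg_snd_le (c : ℝ) (L : ℝ × E →L[ℝ] W) (hL : ‖L‖ ≤ C) :
    ‖c • L.comp ((ContinuousLinearMap.fst ℝ ℝ E).prod (-ContinuousLinearMap.snd ℝ ℝ E))‖ ≤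
      C * ‖c‖ := by
  rw [norm_smul, mul_comm]
  gcongr
  refine (ContinuousLinearMap.opNorm_comp_le _ _).trans ?_
  nlinarith [norm_nonneg L, norm_fst_prod_neg_snd_le (E := E),
    norm_nonneg ((ContinuousLinearMap.fst ℝ ℝ E).prod (-ContinuousLinearMap.snd ℝ ℝ E))]

theorem aestronglyMeasurable_smul_fderiv (hG : ContDiff ℝ 1 G) (hint : Integrable ρ μ)
    (p : ℝ × E) : AEStronglyMeasurable (fun x => ρ x • (fderiv ℝ G (p.1, x - p.2)).comp
    ((ContinuousLinearMap.fst ℝ ℝ E).prod (-ContinuousLinearMap.snd ℝ ℝ E))) μ := by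
  refine hint.aestronglyMeasurable.smul (Continuous.aestronglyMeasurable ?_)
  have := hG.continuous_fderiv one_ne_zero
  fun_prop

theorem integrable_smul_fderiv (hG : ContDiff ℝ 1 G) (hint : Integrable ρ μ)
    (hb : ∀ δ z, a < δ → δ < b → ‖fderiv ℝ G (δ, z)‖ ≤ C) {p : ℝ × E} (hp : p.1 ∈ Ioo a b) :
    Integrable (fun x => ρ x • (fderiv ℝ G (p.1, x - p.2)).comp
      ((ContinuousLinearMap.fst ℝ ℝ E).prod (-ContinuousLinearMap.snd ℝ ℝ E))) μ :=
  (hint.norm.const_mul C).mono' (aestronglyMeasurable_smul_fderiv hG hint p)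
    (ae_of_all _ fun _ => norm_smul_comp_fst_prod_neg_snd_le _ _ (hb _ _ hp.1 hp.2))

theorem integrable_smul_comp_sub (hG : Continuous G) (hint : Integrable ρ μ) (p : ℝ × E)
    (hb : ∀ z, ‖G (p.1, z)‖ ≤ C) : Integrable (fun x => ρ x • G (p.1, x - p.2)) μ := by
  refine (hint.norm.const_mul C).mono' (hint.aestronglyMeasurable.smul
    (Continuous.aestronglyMeasurable (by fun_prop))) (ae_of_all _ fun x => ?_)
  rw [norm_smul, mul_comm]
  gcongr
  exact hb _

/-- All dependence on the parameters sits in the smooth kernel, so `ρ` need only be integrable and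
`C * ‖ρ‖` dominates. -/
theorem hasFDerivAt_integral_sub (hG : ContDiff ℝ 1 G) (hint : Integrable ρ μ)
    (hb₀ : ∀ δ z, a < δ → δ < b → ‖G (δ, z)‖ ≤ C)
    (hb : ∀ δ z, a < δ → δ < b → ‖fderiv ℝ G (δ, z)‖ ≤ C) {p : ℝ × E} (hp : p.1 ∈ Ioo a b) :
    HasFDerivAt (fun p : ℝ × E => ∫ x, ρ x • G (p.1, x - p.2) ∂μ) (fderivIntegralSub μ ρ G p) p := by
  have hU : Prod.fst ⁻¹' Ioo a b ∈ 𝓝 p := continuous_fst.continuousAt (isOpen_Ioo.mem_nhds hp)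
  have hGc := hG.continuous
  refine hasFDerivAt_integral_of_dominated_of_fderiv_le (𝕜 := ℝ)
    (F := fun (q : ℝ × E) x => ρ x • G (q.1, x - q.2))
    (F' := fun q x => ρ x • (fderiv ℝ G (q.1, x - q.2)).comp
      ((ContinuousLinearMap.fst ℝ ℝ E).prod (-ContinuousLinearMap.snd ℝ ℝ E))) (bound := fun x => C * ‖ρ x‖) hU ?_ ?_ ?_ ?_
    (hint.norm.const_mul C) ?_
  · exact Filter.Eventually.of_forall fun q => hint.aestronglyMeasurable.smul
      (Continuous.aestronglyMeasurable (by fun_prop))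
  · exact integrable_smul_comp_sub hGc hint p fun z => hb₀ _ _ hp.1 hp.2
  · exact aestronglyMeasurable_smul_fderiv hG hint p
  · exact ae_of_all _ fun x q hq => norm_smul_comp_fst_prod_neg_snd_le _ _ (hb _ _ hq.1 hq.2)
  · refine ae_of_all _ fun x q _ => HasFDerivAt.const_smul ?_ _
    have h1 : HasFDerivAt (fun q : ℝ × E => (q.1, x - q.2))
        ((ContinuousLinearMap.fst ℝ ℝ E).prod (-ContinuousLinearMap.snd ℝ ℝ E)) q :=
      hasFDerivAt_fst.prodMk (hasFDerivAt_snd.const_sub x)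
    exact ((hG.differentiable one_ne_zero) _).hasFDerivAt.comp q h1

theorem continuousAt_fderivIntegralSub (hG : ContDiff ℝ 1 G) (hint : Integrable ρ μ)
    (hb : ∀ δ z, a < δ → δ < b → ‖fderiv ℝ G (δ, z)‖ ≤ C) {p : ℝ × E} (hp : p.1 ∈ Ioo a b) :
    ContinuousAt (fderivIntegralSub μ ρ G) p := by
  have hU : Prod.fst ⁻¹' Ioo a b ∈ 𝓝 p := continuous_fst.continuousAt (isOpen_Ioo.mem_nhds hp)
  have := hG.continuous_fderiv one_ne_zero
  refine continuousAt_of_dominated (bound := fun x => C * ‖ρ x‖)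
    (Filter.Eventually.of_forall fun q => aestronglyMeasurable_smul_fderiv hG hint q) ?_
    (hint.norm.const_mul C) (ae_of_all _ fun x => ?_)
  · filter_upwards [hU] with q hq
    exact ae_of_all _ fun x => norm_smul_comp_fst_prod_neg_snd_le _ _ (hb _ _ hq.1 hq.2)
  · exact Continuous.continuousAt (by fun_prop)

/-- Strict differentiability is what the implicit function theorem consumes. -/
theorem hasStrictFDerivAt_integral_sub (hG : ContDiff ℝ 1 G) (hint : Integrable ρ μ)
    (hb₀ : ∀ δ z, a < δ → δ < b → ‖G (δ, z)‖ ≤ C)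
    (hb : ∀ δ z, a < δ → δ < b → ‖fderiv ℝ G (δ, z)‖ ≤ C) {p : ℝ × E} (hp : p.1 ∈ Ioo a b) :
    HasStrictFDerivAt (fun p : ℝ × E => ∫ x, ρ x • G (p.1, x - p.2) ∂μ)
      (fderivIntegralSub μ ρ G p) p := by
  have hU : Prod.fst ⁻¹' Ioo a b ∈ 𝓝 p := continuous_fst.continuousAt (isOpen_Ioo.mem_nhds hp)
  refine hasStrictFDerivAt_of_hasFDerivAt_of_continuousAt ?_
    (continuousAt_fderivIntegralSub hG hint hb hp)
  filter_upwards [hU] with q hq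
  exact hasFDerivAt_integral_sub hG hint hb₀ hb hq

theorem fderivIntegralSub_apply (hG : ContDiff ℝ 1 G) (hint : Integrable ρ μ)
    (hb : ∀ δ z, a < δ → δ < b → ‖fderiv ℝ G (δ, z)‖ ≤ C) {p : ℝ × E} (hp : p.1 ∈ Ioo a b)
    (v : ℝ × E) : fderivIntegralSub μ ρ G p v =
      ∫ x, ρ x • fderiv ℝ G (p.1, x - p.2) (v.1, -v.2) ∂μ := by
  rw [fderivIntegralSub, ContinuousLinearMap.integral_apply (integrable_smul_fderiv hG hint hb hp)]
  rfl

end ParametricIntegral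

/-! ### The Gaussian kernels -/

section Kernel

variable {E : Type*} [NormedAddCommGroup E] [InnerProductSpace ℝ E]

/-- The Gaussian kernel `e^{-δ|z|²/2}`. -/
noncomputable def gaussKernel (p : ℝ × E) : ℝ := Real.exp (-(p.1 * ‖p.2‖ ^ 2 / 2))

theorem gaussKernel_pos (p : ℝ × E) : 0 < gaussKernel p := Real.exp_pos _

theorem contDiff_gaussKernel : ContDiff ℝ 1 (gaussKernel (E := E)) :=
  Real.contDiff_exp.comp (((contDiff_fst.mul (contDiff_snd.norm_sq ℝ)).div_const 2).neg)

theorem contDiff_gaussKernel_smul : ContDiff ℝ 1 fun p : ℝ × E => gaussKernel p • p.2 :=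
  contDiff_gaussKernel.smul contDiff_snd

theorem hasFDerivAt_gaussKernel (p : ℝ × E) : HasFDerivAt (gaussKernel (E := E))
    (gaussKernel p • -((‖p.2‖ ^ 2 / 2) • ContinuousLinearMap.fst ℝ ℝ E +
      p.1 • (innerSL ℝ p.2).comp (ContinuousLinearMap.snd ℝ ℝ E))) p := by
  have h1 : HasFDerivAt (fun p : ℝ × E => ‖p.2‖ ^ 2)
      (2 • (innerSL ℝ p.2).comp (ContinuousLinearMap.snd ℝ ℝ E)) p :=
    hasFDerivAt_snd.norm_sq
  have h2 := (((hasFDerivAt_fst (𝕜 := ℝ) (p := p)).mul h1).mul_const (1 / 2 : ℝ)).neg.exp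
  have e : (gaussKernel (E := E)) = fun q : ℝ × E => Real.exp (-(q.1 * ‖q.2‖ ^ 2 * (1 / 2))) := by
    ext q; rw [gaussKernel]; congr 1; ring
  rw [e]
  convert! h2 using 1
  ext v <;> simp <;> ring

theorem fderiv_gaussKernel_apply (p v : ℝ × E) : fderiv ℝ gaussKernel p v =
    -(gaussKernel p * (‖p.2‖ ^ 2 / 2 * v.1 + p.1 * ⟪p.2, v.2⟫_ℝ)) := by
  rw [(hasFDerivAt_gaussKernel p).fderiv]
  simp
  ring

theorem fderiv_gaussKernel_smul_apply (p v : ℝ × E) :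
    fderiv ℝ (fun p : ℝ × E => gaussKernel p • p.2) p v =
      gaussKernel p • v.2 -
        (gaussKernel p * (‖p.2‖ ^ 2 / 2 * v.1 + p.1 * ⟪p.2, v.2⟫_ℝ)) • p.2 := by
  have h : HasFDerivAt (fun p : ℝ × E => gaussKernel p • p.2) _ p :=
    (hasFDerivAt_gaussKernel p).smul hasFDerivAt_snd
  rw [h.fderiv]
  simp only [add_apply, smul_apply,
    ContinuousLinearMap.smulRight_apply, neg_apply,
    ContinuousLinearMap.comp_apply, ContinuousLinearMap.coe_fst', ContinuousLinearMap.coe_snd',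
    innerSL_apply_apply, smul_eq_mul]
  module

/-- The constant comes from `u² / 2 ≤ e^u` at `u = a‖z‖² / 2`; lower powers are below `1 + ‖z‖⁴`. -/
theorem pow_norm_mul_gaussKernel_le {a : ℝ} (ha : 0 < a) {p : ℝ × E} (hp : a < p.1) {k : ℕ}
    (hk : k ≤ 4) : ‖p.2‖ ^ k * gaussKernel p ≤ 1 + 8 / a ^ 2 := by
  set s := ‖p.2‖
  have hs : 0 ≤ s := norm_nonneg _
  set u := a * s ^ 2 / 2 with hu
  have hu0 : 0 ≤ u := by positivity
  have hle : gaussKernel p ≤ Real.exp (-u) := by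
    refine Real.exp_le_exp.2 (neg_le_neg ?_)
    rw [hu]
    gcongr
  have h1 : s ^ k ≤ 1 + s ^ 4 := by
    rcases le_total s 1 with h | h
    · have := pow_le_one₀ (n := k) hs h
      have : 0 ≤ s ^ 4 := by positivity
      linarith
    · have := pow_le_pow_right₀ h hk
      linarith
  have h2 : s ^ 4 * Real.exp (-u) ≤ 8 / a ^ 2 := by
    have := Real.pow_div_factorial_le_exp u hu0 2
    rw [Real.exp_neg, ← div_eq_mul_inv, div_le_div_iff₀ (Real.exp_pos _) (by positivity)]
    have e : s ^ 4 * a ^ 2 = 8 * (u ^ 2 / (Nat.factorial 2 : ℕ)) := by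
      rw [hu]; norm_num [Nat.factorial]; ring
    rw [e]
    gcongr
  have h3 : Real.exp (-u) ≤ 1 := Real.exp_le_one_iff.2 (by linarith)
  calc s ^ k * gaussKernel p ≤ (1 + s ^ 4) * Real.exp (-u) := by
        gcongr
        exact (gaussKernel_pos p).le
    _ ≤ _ := by linarith

theorem exists_gaussKernel_bound {a b : ℝ} (ha : 0 < a) : ∃ C, ∀ (δ : ℝ) (z : E), a < δ → δ < b →
    ‖gaussKernel (δ, z)‖ ≤ C ∧ ‖fderiv ℝ gaussKernel (δ, z)‖ ≤ C ∧ ‖gaussKernel (δ, z) • z‖ ≤ C ∧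
      ‖fderiv ℝ (fun p : ℝ × E => gaussKernel p • p.2) (δ, z)‖ ≤ C := by
  set M := 1 + 8 / a ^ 2 with hM
  have hM0 : 0 < M := by positivity
  refine ⟨M * (2 + |b|), fun δ z hδ hδb => ?_⟩
  have hδ0 : 0 < δ := ha.trans hδ
  have hb : δ ≤ |b| := hδb.le.trans (le_abs_self b)
  have hb0 : 0 ≤ |b| := abs_nonneg b
  set g := gaussKernel (δ, z) with hg
  have hg0 : 0 < g := gaussKernel_pos _
  have m : ∀ k ≤ 4, ‖z‖ ^ k * g ≤ M := fun k hk =>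
    pow_norm_mul_gaussKernel_le ha (p := (δ, z)) hδ hk
  have m0 : g ≤ M := by simpa using m 0 (by norm_num)
  have m1 : ‖z‖ * g ≤ M := by simpa using m 1 (by norm_num)
  have m2 : ‖z‖ ^ 2 * g ≤ M := m 2 (by norm_num)
  have m3 : ‖z‖ ^ 3 * g ≤ M := m 3 (by norm_num)
  have hMb : 0 ≤ M * |b| := by positivity
  have inner_le : ∀ v : ℝ × E, |‖z‖ ^ 2 / 2 * v.1 + δ * ⟪z, v.2⟫_ℝ| ≤
      (‖z‖ ^ 2 + |b| * ‖z‖) * ‖v‖ := by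
    intro v
    have h1 : |v.1| ≤ ‖v‖ := norm_fst_le v
    have h2 : |⟪z, v.2⟫_ℝ| ≤ ‖z‖ * ‖v‖ :=
      (abs_real_inner_le_norm z v.2).trans (by gcongr; exact norm_snd_le v)
    calc |‖z‖ ^ 2 / 2 * v.1 + δ * ⟪z, v.2⟫_ℝ| ≤ ‖z‖ ^ 2 / 2 * |v.1| + δ * |⟪z, v.2⟫_ℝ| := by
          refine (abs_add_le _ _).trans (le_of_eq ?_)
          rw [abs_mul, abs_mul, abs_of_pos hδ0, abs_of_nonneg (by positivity)]
      _ ≤ ‖z‖ ^ 2 * ‖v‖ + |b| * (‖z‖ * ‖v‖) := by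
          gcongr
          linarith [sq_nonneg ‖z‖]
      _ = _ := by ring
  refine ⟨?_, ?_, ?_, ?_⟩
  · rw [Real.norm_of_nonneg hg0.le]; nlinarith
  · refine ContinuousLinearMap.opNorm_le_bound _ (by positivity) fun v => ?_
    rw [fderiv_gaussKernel_apply, norm_neg, norm_mul, Real.norm_of_nonneg hg0.le, Real.norm_eq_abs]
    calc g * _ ≤ g * ((‖z‖ ^ 2 + |b| * ‖z‖) * ‖v‖) := by gcongr; exact inner_le v
      _ = (‖z‖ ^ 2 * g + |b| * (‖z‖ * g)) * ‖v‖ := by ring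
      _ ≤ (M + |b| * M) * ‖v‖ := by gcongr
      _ ≤ _ := by gcongr; linarith
  · rw [norm_smul, Real.norm_of_nonneg hg0.le, mul_comm]
    nlinarith
  · refine ContinuousLinearMap.opNorm_le_bound _ (by positivity) fun v => ?_
    rw [fderiv_gaussKernel_smul_apply]
    refine (norm_sub_le _ _).trans ?_
    rw [norm_smul, norm_smul, norm_mul, Real.norm_of_nonneg hg0.le, Real.norm_eq_abs]
    calc g * ‖v.2‖ + g * _ * ‖z‖ ≤ g * ‖v‖ + g * ((‖z‖ ^ 2 + |b| * ‖z‖) * ‖v‖) * ‖z‖ := by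
          gcongr
          · exact norm_snd_le v
          · exact inner_le v
      _ = (g + ‖z‖ ^ 3 * g + |b| * (‖z‖ ^ 2 * g)) * ‖v‖ := by ring
      _ ≤ (M + M + |b| * M) * ‖v‖ := by gcongr
      _ = _ := by ring

end Kernel

/-! ### The tilted mass, its critical points, and their dependence on `δ`. -/

section Tilt

variable {n : ℕ} {ρ : EuclideanSpace ℝ (Fin n) → ℝ}

/-- The total mass of the density `tilt ρ p.1 p.2`. -/
noncomputable def tiltMass (ρ : EuclideanSpace ℝ (Fin n) → ℝ)
    (p : ℝ × EuclideanSpace ℝ (Fin n)) : ℝ :=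
  ∫ x, tilt ρ p.1 p.2 x

/-- The first moment about `p.2` of the density `tilt ρ p.1 p.2`. -/
noncomputable def tiltMoment (ρ : EuclideanSpace ℝ (Fin n) → ℝ)
    (p : ℝ × EuclideanSpace ℝ (Fin n)) : EuclideanSpace ℝ (Fin n) :=
  ∫ x, tilt ρ p.1 p.2 x • (x - p.2)

theorem tilt_eq (δ : ℝ) (m x : EuclideanSpace ℝ (Fin n)) :
    tilt ρ δ m x = ρ x * gaussKernel (δ, x - m) := mul_comm _ _

theorem integrable_tilt (hint : Integrable ρ) {δ : ℝ} (hδ : 0 ≤ δ) (m : EuclideanSpace ℝ (Fin n)) :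
    Integrable fun x => tilt ρ δ m x :=
  hint.bdd_mul (c := 1) (by fun_prop) (ae_of_all _ fun x => by
    rw [Real.norm_of_nonneg (Real.exp_pos _).le]
    exact exp_neg_mul_sq_le_one hδ _)

theorem integrable_tilt_smul (hint : Integrable ρ) (h2 : Integrable fun x => ‖x‖ ^ 2 * ρ x)
    {δ : ℝ} (hδ : 0 ≤ δ) (m : EuclideanSpace ℝ (Fin n)) :
    Integrable fun x => tilt ρ δ m x • x := by
  have hm : AEStronglyMeasurable (fun x => tilt ρ δ m x • x) :=
    (integrable_tilt hint hδ m).aestronglyMeasurable.smul (by fun_prop)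
  refine (hint.norm.add h2.norm).mono' hm (ae_of_all _ fun x => ?_)
  rw [norm_smul, tilt, norm_mul, Real.norm_of_nonneg (Real.exp_pos _).le, Pi.add_apply, norm_mul,
    Real.norm_of_nonneg (sq_nonneg ‖x‖)]
  have h1 := exp_neg_mul_sq_le_one hδ ‖x - m‖
  have h3 : ‖x‖ ≤ 1 + ‖x‖ ^ 2 := by nlinarith [sq_nonneg (‖x‖ - 1), norm_nonneg x]
  calc Real.exp (-(δ * ‖x - m‖ ^ 2 / 2)) * ‖ρ x‖ * ‖x‖ ≤ 1 * ‖ρ x‖ * (1 + ‖x‖ ^ 2) := by gcongr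
    _ = _ := by ring

theorem isBarycenter_iff (hint : Integrable ρ) (h2 : Integrable fun x => ‖x‖ ^ 2 * ρ x)
    {δ : ℝ} (hδ : 0 ≤ δ) (m : EuclideanSpace ℝ (Fin n)) :
    IsBarycenter ρ δ m ↔ tiltMoment ρ (δ, m) = 0 := by
  simp only [tiltMoment, smul_sub]
  rw [integral_sub (integrable_tilt_smul hint h2 hδ m) ((integrable_tilt hint hδ m).smul_const m),
    integral_smul_const, sub_eq_zero]
  rfl

theorem integrable_tilt_smul_sub (hint : Integrable ρ) {δ : ℝ} (hδ : 0 < δ)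
    (m : EuclideanSpace ℝ (Fin n)) : Integrable fun x => tilt ρ δ m x • (x - m) := by
  obtain ⟨C, hC⟩ := exists_gaussKernel_bound (E := EuclideanSpace ℝ (Fin n)) (b := 2 * δ)
    (half_pos hδ)
  refine (integrable_smul_comp_sub contDiff_gaussKernel_smul.continuous hint (δ, m)
    (fun z => (hC δ z (by linarith) (by linarith)).2.2.1)).congr (ae_of_all _ fun x => ?_)
  simp only [tilt_eq, smul_smul]

theorem inner_tiltMoment (hint : Integrable ρ) {δ : ℝ} (hδ : 0 < δ)
    (m v : EuclideanSpace ℝ (Fin n)) :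
    ⟪v, tiltMoment ρ (δ, m)⟫_ℝ = ∫ x, ⟪x - m, v⟫_ℝ * tilt ρ δ m x := by
  rw [tiltMoment, ← integral_inner (integrable_tilt_smul_sub hint hδ m)]
  congr 1
  ext x
  rw [inner_smul_right, real_inner_comm, mul_comm]

/-- Only the derivative in `m` is made explicit: it identifies zeros of `tiltMoment` with critical
points of the mass. -/
theorem exists_hasStrictFDerivAt_tiltMass (hint : Integrable ρ)
    {p : ℝ × EuclideanSpace ℝ (Fin n)} (hp : 0 < p.1) :
    ∃ L : ℝ × EuclideanSpace ℝ (Fin n) →L[ℝ] ℝ, HasStrictFDerivAt (tiltMass ρ) L p ∧ ∀ v, L (0, v) = p.1 * ⟪tiltMoment ρ p, v⟫_ℝ := by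
  obtain ⟨C, hC⟩ := exists_gaussKernel_bound (E := EuclideanSpace ℝ (Fin n)) (b := 2 * p.1)
    (half_pos hp)
  have hI : p.1 ∈ Ioo (p.1 / 2) (2 * p.1) := ⟨by linarith, by linarith⟩
  have hd := hasStrictFDerivAt_integral_sub contDiff_gaussKernel hint
    (fun δ z h h' => (hC δ z h h').1) (fun δ z h h' => (hC δ z h h').2.1) hI
  have e : tiltMass ρ = fun p : ℝ × EuclideanSpace ℝ (Fin n) =>
      ∫ x, ρ x • gaussKernel (p.1, x - p.2) := by
    ext1 q
    simp only [tiltMass, tilt_eq, smul_eq_mul]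
  rw [e]
  refine ⟨_, hd, fun v => ?_⟩
  rw [fderivIntegralSub_apply contDiff_gaussKernel hint (fun δ z h h' => (hC δ z h h').2.1) hI]
  rw [real_inner_comm, inner_tiltMoment hint hp, ← integral_const_mul]
  congr 1
  ext x
  rw [fderiv_gaussKernel_apply, tilt_eq]
  simp
  ring

/-- The quadratic form of the `m`-derivative is all that is needed, both for concavity along lines
and for invertibility at a barycenter. -/
theorem exists_hasStrictFDerivAt_tiltMoment (hint : Integrable ρ)
    {p : ℝ × EuclideanSpace ℝ (Fin n)} (hp : 0 < p.1) :
    ∃ L : ℝ × EuclideanSpace ℝ (Fin n) →L[ℝ] EuclideanSpace ℝ (Fin n),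
      HasStrictFDerivAt (tiltMoment ρ) L p ∧ ∀ v, ⟪v, L (0, v)⟫_ℝ =
      p.1 * (∫ x, ⟪x - p.2, v⟫_ℝ ^ 2 * tilt ρ p.1 p.2 x) - ‖v‖ ^ 2 * tiltMass ρ p := by
  obtain ⟨C, hC⟩ := exists_gaussKernel_bound (E := EuclideanSpace ℝ (Fin n)) (b := 2 * p.1)
    (half_pos hp)
  have hI : p.1 ∈ Ioo (p.1 / 2) (2 * p.1) := ⟨by linarith, by linarith⟩
  have hb := fun δ z h h' => (hC δ z h h').2.2.2
  have hd := hasStrictFDerivAt_integral_sub contDiff_gaussKernel_smul hint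
    (fun δ z h h' => (hC δ z h h').2.2.1) hb hI
  have e : tiltMoment ρ = fun p : ℝ × EuclideanSpace ℝ (Fin n) =>
      ∫ x, ρ x • (gaussKernel (p.1, x - p.2) • (x - p.2)) := by
    ext1 q
    simp only [tiltMoment, tilt_eq, smul_smul]
  rw [e]
  refine ⟨_, hd, fun v => ?_⟩
  rw [fderivIntegralSub_apply contDiff_gaussKernel_smul hint hb hI]
  have hi := (integrable_smul_fderiv contDiff_gaussKernel_smul hint hb hI).apply_continuousLinearMap
    (0, v)
  have hi' : Integrable fun x => ρ x • fderiv ℝ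
      (fun p : ℝ × EuclideanSpace ℝ (Fin n) => gaussKernel p • p.2) (p.1, x - p.2) (0, -v) := hi
  have e1 : ∀ x, ⟪v, ρ x • fderiv ℝ
      (fun p : ℝ × EuclideanSpace ℝ (Fin n) => gaussKernel p • p.2) (p.1, x - p.2) (0, -v)⟫_ℝ =
      p.1 * (⟪x - p.2, v⟫_ℝ ^ 2 * tilt ρ p.1 p.2 x) - ‖v‖ ^ 2 * tilt ρ p.1 p.2 x := by
    intro x
    rw [fderiv_gaussKernel_smul_apply, inner_smul_right, inner_sub_right, inner_smul_right,
      inner_smul_right, inner_neg_right, inner_neg_right, real_inner_self_eq_norm_sq,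
      real_inner_comm (x - p.2) v, tilt_eq]
    ring
  have ht := (integrable_tilt hint hp.le p.2).const_mul (‖v‖ ^ 2)
  have hi2 : Integrable fun x => p.1 * (⟪x - p.2, v⟫_ℝ ^ 2 * tilt ρ p.1 p.2 x) := by
    refine ((hi'.const_inner v).add ht).congr (ae_of_all _ fun x => ?_)
    simp only [Pi.add_apply]
    rw [e1]
    ring
  rw [← integral_inner hi', tiltMass, ← integral_const_mul, ← integral_const_mul,
    ← integral_sub hi2 ht]
  exact integral_congr_ae (ae_of_all _ e1)

theorem tiltMass_pos (h0 : ∀ x, 0 ≤ ρ x) (hint : Integrable ρ) (hpos : 0 < ∫ x, ρ x)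
    {p : ℝ × EuclideanSpace ℝ (Fin n)} (hp : 0 ≤ p.1) : 0 < tiltMass ρ p := by
  rw [tiltMass, integral_pos_iff_support_of_nonneg (f := fun x => tilt ρ p.1 p.2 x)
    (fun x => mul_nonneg (Real.exp_pos _).le (h0 x)) (integrable_tilt hint hp p.2)]
  rw [integral_pos_iff_support_of_nonneg h0 hint] at hpos
  convert hpos using 2
  ext x
  simp [tilt, (Real.exp_pos _).ne']

/-- On the line from `m` to `y`, the logarithmic derivative of the mass is `δ * ψ / f`. The variance
bound makes it strictly decreasing, and it vanishes at `m`. -/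
theorem tiltMass_lt_of_tiltMoment_eq_zero (hρ : LogConcave fun x => ENNReal.ofReal (ρ x))
    (h0 : ∀ x, 0 ≤ ρ x) (hint : Integrable ρ) (hpos : 0 < ∫ x, ρ x) {δ : ℝ} (hδ : 0 < δ)
    {m y : EuclideanSpace ℝ (Fin n)} (hm : tiltMoment ρ (δ, m) = 0) (hy : y ≠ m) :
    tiltMass ρ (δ, y) < tiltMass ρ (δ, m) := by
  set e := y - m with he
  have he0 : e ≠ 0 := sub_ne_zero.2 hy
  set c : ℝ → ℝ × EuclideanSpace ℝ (Fin n) := fun t => (δ, m + t • e) with hc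
  have hcd : ∀ t, HasDerivAt c (0, e) t := fun t =>
    (hasDerivAt_const t δ).prodMk (by simpa using ((hasDerivAt_id t).smul_const e).const_add m)
  set f : ℝ → ℝ := fun t => tiltMass ρ (c t) with hf
  set ψ : ℝ → ℝ := fun t => ⟪e, tiltMoment ρ (c t)⟫_ℝ with hψ
  have hfpos : ∀ t, 0 < f t := fun t => tiltMass_pos h0 hint hpos hδ.le
  have hfd : ∀ t, HasDerivAt f (δ * ψ t) t := fun t => by
    obtain ⟨L, hL, hLv⟩ := exists_hasStrictFDerivAt_tiltMass hint (p := c t) hδ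
    have := hL.hasFDerivAt.comp_hasDerivAt t (hcd t)
    rw [hLv, real_inner_comm] at this
    exact this
  have hψd : ∀ t, HasDerivAt ψ
      (δ * (∫ x, ⟪x - (c t).2, e⟫_ℝ ^ 2 * tilt ρ δ (c t).2 x) - ‖e‖ ^ 2 * f t) t := fun t => by
    obtain ⟨L, hL, hLv⟩ := exists_hasStrictFDerivAt_tiltMoment hint (p := c t) hδ
    have := (innerSL ℝ e).hasFDerivAt.comp_hasDerivAt t
      (hL.hasFDerivAt.comp_hasDerivAt t (hcd t))
    rw [innerSL_apply_apply, hLv] at this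
    exact this
  have hψ' : ∀ t, ψ t = ∫ x, ⟪x - (c t).2, e⟫_ℝ * tilt ρ δ (c t).2 x :=
    fun t => inner_tiltMoment hint hδ _ _
  have hquot : ∀ t, HasDerivAt (fun t => ψ t / f t)
      (((δ * (∫ x, ⟪x - (c t).2, e⟫_ℝ ^ 2 * tilt ρ δ (c t).2 x) - ‖e‖ ^ 2 * f t) * f t -
        ψ t * (δ * ψ t)) / f t ^ 2) t := fun t => (hψd t).div (hfd t) (hfpos t).ne'
  have hanti : StrictAnti fun t => ψ t / f t := by
    refine strictAnti_of_deriv_neg fun t => ?_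
    rw [(hquot t).deriv]
    refine div_neg_of_neg_of_pos ?_ (pow_pos (hfpos t) 2)
    have := hρ.tilt_variance_lt h0 hint hδ (c t).2 (hfpos t) he0
    rw [← hψ' t] at this
    change δ * (f t * _ - _) < ‖e‖ ^ 2 * f t ^ 2 at this
    linarith
  have hψ0 : ψ 0 = 0 := by simp [hψ, hc, hm]
  have hψneg : ∀ t, 0 < t → ψ t < 0 := fun t ht => by
    have := hanti ht
    simp only [hψ0, zero_div] at this
    exact (div_neg_iff.1 this).elim (fun h => absurd h.2 (hfpos t).not_gt) fun h => h.1
  have hfanti : StrictAntiOn f (Icc 0 1) := by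
    refine strictAntiOn_of_deriv_neg (convex_Icc 0 1)
      (fun t _ => (hfd t).continuousAt.continuousWithinAt) fun t ht => ?_
    rw [interior_Icc] at ht
    rw [(hfd t).deriv]
    exact mul_neg_of_pos_of_neg hδ (hψneg t ht.1)
  have := hfanti (left_mem_Icc.2 zero_le_one) (right_mem_Icc.2 zero_le_one) zero_lt_one
  simpa [hf, hc, he] using this

theorem tendsto_tiltMass_cocompact (hint : Integrable ρ) {δ : ℝ} (hδ : 0 < δ) :
    Filter.Tendsto (fun m => tiltMass ρ (δ, m)) (Filter.cocompact (EuclideanSpace ℝ (Fin n)))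
      (𝓝 0) := by
  have : ∫ _ : EuclideanSpace ℝ (Fin n), (0 : ℝ) = 0 := integral_zero _ _
  rw [← this]
  simp only [tiltMass]
  have : (Filter.cocompact (EuclideanSpace ℝ (Fin n))).IsCountablyGenerated := by
    rw [← Metric.cobounded_eq_cocompact, ← comap_norm_atTop]
    infer_instance
  refine tendsto_integral_filter_of_dominated_convergence (fun x => ‖ρ x‖)
    (Filter.Eventually.of_forall fun m => (integrable_tilt hint hδ.le m).aestronglyMeasurable)
    (Filter.Eventually.of_forall fun m => ae_of_all _ fun x => ?_) hint.norm
    (ae_of_all _ fun x => ?_)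
  · rw [tilt, norm_mul, Real.norm_of_nonneg (Real.exp_pos _).le]
    exact mul_le_of_le_one_left (norm_nonneg _) (exp_neg_mul_sq_le_one hδ.le _)
  · have h1 : Filter.Tendsto (fun m : EuclideanSpace ℝ (Fin n) => ‖x - m‖)
        (Filter.cocompact _) Filter.atTop :=
      tendsto_norm_cocompact_atTop.comp (Homeomorph.subLeft x).isClosedEmbedding.tendsto_cocompact
    have h2 : Filter.Tendsto (fun m : EuclideanSpace ℝ (Fin n) => -(δ * ‖x - m‖ ^ 2 / 2))
        (Filter.cocompact _) Filter.atBot :=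
      Filter.tendsto_neg_atTop_atBot.comp ((((Filter.tendsto_pow_atTop two_ne_zero).comp
        h1).const_mul_atTop hδ).atTop_div_const two_pos)
    simpa [tilt] using (Real.tendsto_exp_atBot.comp h2).mul_const (ρ x)

/-- The mass is continuous, positive and vanishes at infinity, so it attains its maximum, where its
gradient is zero. -/
theorem exists_tiltMoment_eq_zero (h0 : ∀ x, 0 ≤ ρ x) (hint : Integrable ρ) (hpos : 0 < ∫ x, ρ x)
    {δ : ℝ} (hδ : 0 < δ) : ∃ m, tiltMoment ρ (δ, m) = 0 := by
  have hd : ∀ m : EuclideanSpace ℝ (Fin n), ∃ L : EuclideanSpace ℝ (Fin n) →L[ℝ] ℝ,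
      HasFDerivAt (fun m => tiltMass ρ (δ, m)) L m ∧
        ∀ v, L v = δ * ⟪tiltMoment ρ (δ, m), v⟫_ℝ := fun m => by
    obtain ⟨L, hL, hLv⟩ := exists_hasStrictFDerivAt_tiltMass hint (p := (δ, m)) hδ
    refine ⟨L.comp (ContinuousLinearMap.inr ℝ ℝ _), hL.hasFDerivAt.comp m (hasFDerivAt_prodMk_right δ m),
      fun v => hLv v⟩
  have hcont : Continuous fun m : EuclideanSpace ℝ (Fin n) => tiltMass ρ (δ, m) :=
    continuous_iff_continuousAt.2 fun m => (hd m).choose_spec.1.continuousAt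
  obtain ⟨m, hm⟩ := hcont.exists_forall_ge' 0
    (((tendsto_tiltMass_cocompact hint hδ).eventually
      (gt_mem_nhds (tiltMass_pos h0 hint hpos (p := (δ, 0)) hδ.le))).mono fun _ h => h.le)
  refine ⟨m, ?_⟩
  obtain ⟨L, hL, hLv⟩ := hd m
  have hL0 : L = 0 := IsLocalMax.hasFDerivAt_eq_zero (Filter.Eventually.of_forall hm) hL
  have := hLv (tiltMoment ρ (δ, m))
  rw [hL0] at this
  simpa [hδ.ne'] using this

/-- The barycenter depends on the parameter in a locally Lipschitz way. -/
theorem exists_lipschitzOnWith_of_tiltMoment_eq_zero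
    (hρ : LogConcave fun x => ENNReal.ofReal (ρ x)) (h0 : ∀ x, 0 ≤ ρ x) (hint : Integrable ρ)
    (hpos : 0 < ∫ x, ρ x) {m : ℝ → EuclideanSpace ℝ (Fin n)}
    (hm : ∀ δ, 0 < δ → tiltMoment ρ (δ, m δ) = 0) {δ : ℝ} (hδ : 0 < δ) :
    ∃ K, ∃ s ∈ 𝓝 δ, LipschitzOnWith K m s := by
  obtain ⟨L, hL, hLv⟩ := exists_hasStrictFDerivAt_tiltMoment hint (p := (δ, m δ)) hδ
  -- At a barycenter the first moment drops out of the variance bound, which then says that this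
  -- operator is negative definite.
  have hinj : Function.Injective (L ∘L ContinuousLinearMap.inr ℝ ℝ (EuclideanSpace ℝ (Fin n))) := by
    refine (injective_iff_map_eq_zero _).2 fun v hv => ?_
    by_contra hv0
    have h1 := hLv v
    have h2 : L (0, v) = 0 := hv
    rw [h2, inner_zero_right] at h1
    have hF := tiltMass_pos h0 hint hpos (p := (δ, m δ)) hδ.le
    have h3 := hρ.tilt_variance_lt h0 hint hδ (m δ) hF hv0
    change δ * (tiltMass ρ (δ, m δ) * _ - _) < ‖v‖ ^ 2 * tiltMass ρ (δ, m δ) ^ 2 at h3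
    simp only at h1
    have h4 : ∫ x, ⟪x - m δ, v⟫_ℝ * tilt ρ δ (m δ) x = 0 := by
      rw [← inner_tiltMoment hint hδ, hm δ hδ, inner_zero_right]
    rw [h4] at h3
    nlinarith
  have hinv : (L ∘L ContinuousLinearMap.inr ℝ ℝ (EuclideanSpace ℝ (Fin n))).IsInvertible :=
    ⟨(LinearEquiv.ofInjectiveEndo _ hinj).toContinuousLinearEquiv, by ext1 v; rfl⟩
  obtain ⟨K, s, hs, hK⟩ := (hL.hasStrictFDerivAt_implicitFunctionOfProdDomain hinv).exists_lipschitzOnWith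
  have hev := hL.eventually_apply_implicitFunctionOfProdDomain hinv
  -- Zeros of the moment are unique, so the implicit function coincides with `m` near `δ`, without
  -- assuming `m` continuous.
  have heq : ∀ x ∈ {x | tiltMoment ρ (x, hL.implicitFunctionOfProdDomain hinv x) =
      tiltMoment ρ (δ, m δ)} ∩ Ioi 0, m x = hL.implicitFunctionOfProdDomain hinv x := by
    rintro x ⟨hx1, hx2⟩
    rw [mem_ofPred_eq, hm δ hδ] at hx1
    by_contra hne
    exact lt_asymm (tiltMass_lt_of_tiltMoment_eq_zero hρ h0 hint hpos hx2 hx1 hne)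
      (tiltMass_lt_of_tiltMoment_eq_zero hρ h0 hint hpos hx2 (hm x hx2) (Ne.symm hne))
  refine ⟨K, s ∩ _, Filter.inter_mem hs (Filter.inter_mem hev (Ioi_mem_nhds hδ)),
    fun x hx y hy => ?_⟩
  rw [heq x hx.2, heq y hy.2]
  exact hK hx.1 hy.1

end Tilt

/-! ### Lower bounds for the maximal tilted mass. -/

section Bound

variable {n : ℕ} {ρ : EuclideanSpace ℝ (Fin n) → ℝ}

theorem integrable_densityMeasure_iff (h0 : ∀ x, 0 ≤ ρ x) (hint : Integrable ρ)
    {f : EuclideanSpace ℝ (Fin n) → ℝ} :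
    Integrable f (densityMeasure ρ) ↔ Integrable fun x => f x * ρ x := by
  have := integrable_withDensity_iff_integrable_smul₀ (μ := volume)
    hint.aestronglyMeasurable.aemeasurable.real_toNNReal (g := f)
  refine this.trans (integrable_congr (ae_of_all _ fun x => ?_))
  simp only [NNReal.smul_def, Real.coe_toNNReal _ (h0 x), smul_eq_mul, mul_comm]

theorem integral_densityMeasure (h0 : ∀ x, 0 ≤ ρ x) (hint : Integrable ρ)
    (f : EuclideanSpace ℝ (Fin n) → ℝ) :
    ∫ x, f x ∂(densityMeasure ρ) = ∫ x, f x * ρ x := by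
  have := integral_withDensity_eq_integral_smul₀ (μ := volume)
    hint.aestronglyMeasurable.aemeasurable.real_toNNReal f
  refine this.trans (integral_congr_ae (ae_of_all _ fun x => ?_))
  simp only [NNReal.smul_def, Real.coe_toNNReal _ (h0 x), smul_eq_mul, mul_comm]

theorem integrable_sq_norm_sub_mul (hint : Integrable ρ)
    (h2 : Integrable fun x => ‖x‖ ^ 2 * ρ x) (c : EuclideanSpace ℝ (Fin n)) :
    Integrable fun x => ‖x - c‖ ^ 2 * ρ x := by
  refine ((h2.norm.const_mul 2).add (hint.norm.const_mul (2 * ‖c‖ ^ 2))).mono'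
    (AEStronglyMeasurable.mul (by fun_prop) hint.aestronglyMeasurable) (ae_of_all _ fun x => ?_)
  rw [Pi.add_apply, norm_mul, norm_mul, Real.norm_of_nonneg (sq_nonneg _),
    Real.norm_of_nonneg (sq_nonneg _)]
  have h1 : ‖x - c‖ ^ 2 ≤ 2 * ‖x‖ ^ 2 + 2 * ‖c‖ ^ 2 := by
    have := norm_sub_le x c
    nlinarith [norm_nonneg (x - c), norm_nonneg x, norm_nonneg c, sq_nonneg (‖x‖ - ‖c‖)]
  calc ‖x - c‖ ^ 2 * ‖ρ x‖ ≤ (2 * ‖x‖ ^ 2 + 2 * ‖c‖ ^ 2) * ‖ρ x‖ := by gcongr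
    _ = _ := by ring

/-- Jensen's inequality: the tangent line to `exp` at the mean of `-δ|x - c|²/2` lies below `exp`
and integrates to the left-hand side. -/
theorem exp_neg_le_tiltMass (h0 : ∀ x, 0 ≤ ρ x) (hint : Integrable ρ) (hone : ∫ x, ρ x = 1)
    (h2 : Integrable fun x => ‖x‖ ^ 2 * ρ x) {δ : ℝ} (hδ : 0 ≤ δ)
    (c : EuclideanSpace ℝ (Fin n)) :
    Real.exp (-(δ / 2 * ∫ x, ‖x - c‖ ^ 2 ∂(densityMeasure ρ))) ≤ tiltMass ρ (δ, c) := by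
  rw [integral_densityMeasure h0 hint]
  have hi := integrable_sq_norm_sub_mul hint h2 c
  set v := ∫ x, ‖x - c‖ ^ 2 * ρ x
  set E := Real.exp (-(δ / 2 * v)) with hE
  have h3 : ∫ x, (E * (1 + δ / 2 * v) * ρ x - E * (δ / 2) * (‖x - c‖ ^ 2 * ρ x)) = E := by
    rw [integral_sub (hint.const_mul _) (hi.const_mul _), integral_const_mul, integral_const_mul,
      hone]
    change E * (1 + δ / 2 * v) * 1 - E * (δ / 2) * v = E
    ring
  rw [← h3]
  refine integral_mono ((hint.const_mul _).sub (hi.const_mul _)) (integrable_tilt hint hδ c)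
    fun x => ?_
  simp only [tilt]
  have h4 := Real.add_one_le_exp (-(δ * ‖x - c‖ ^ 2 / 2) + δ / 2 * v)
  have h5 : E * (1 + δ / 2 * v - δ / 2 * ‖x - c‖ ^ 2) ≤ Real.exp (-(δ * ‖x - c‖ ^ 2 / 2)) := by
    have e : Real.exp (-(δ * ‖x - c‖ ^ 2 / 2)) =
        E * Real.exp (-(δ * ‖x - c‖ ^ 2 / 2) + δ / 2 * v) := by
      rw [hE, ← Real.exp_add]; congr 1; ring
    rw [e]
    exact mul_le_mul_of_nonneg_left (by linarith) (Real.exp_pos _).le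
  have := mul_le_mul_of_nonneg_right h5 (h0 x)
  linarith

/-- Maximality at `m` permits Jensen's bound at any centre `c`, hence the infimum over `c`. -/
theorem neg_log_tiltMass_le (h0 : ∀ x, 0 ≤ ρ x) (hint : Integrable ρ) (hone : ∫ x, ρ x = 1)
    (h2 : Integrable fun x => ‖x‖ ^ 2 * ρ x) {δ : ℝ} (hδ : 0 < δ)
    {m : EuclideanSpace ℝ (Fin n)} (hm : ∀ y, tiltMass ρ (δ, y) ≤ tiltMass ρ (δ, m)) :
    -Real.log (tiltMass ρ (δ, m)) ≤ δ / 2 * totalVar (densityMeasure ρ) := by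
  have hc : ∀ c, -Real.log (tiltMass ρ (δ, m)) / (δ / 2) ≤ ∫ x, ‖x - c‖ ^ 2 ∂(densityMeasure ρ) := by
    intro c
    rw [div_le_iff₀ (by positivity), mul_comm]
    have h3 := (exp_neg_le_tiltMass h0 hint hone h2 hδ.le c).trans (hm c)
    have := Real.log_le_log (Real.exp_pos _) h3
    rw [Real.log_exp] at this
    linarith
  have := le_ciInf hc
  rw [div_le_iff₀ (by positivity)] at this
  rw [mul_comm]
  exact this

theorem tiltMass_lt_one (hn : 1 ≤ n) (h0 : ∀ x, 0 ≤ ρ x) (hint : Integrable ρ)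
    (hone : ∫ x, ρ x = 1) {δ : ℝ} (hδ : 0 < δ) (m : EuclideanSpace ℝ (Fin n)) :
    tiltMass ρ (δ, m) < 1 := by
  have : NeZero n := ⟨by omega⟩
  rw [← hone, ← sub_pos, tiltMass, ← integral_sub hint (integrable_tilt hint hδ.le m)]
  have hnn : ∀ x, 0 ≤ ρ x - tilt ρ δ m x := fun x => by
    have := mul_le_mul_of_nonneg_right (exp_neg_mul_sq_le_one hδ.le ‖x - m‖) (h0 x)
    rw [tilt]; linarith
  rw [integral_pos_iff_support_of_nonneg hnn (hint.sub (integrable_tilt hint hδ.le m))]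
  have hpos : 0 < ∫ x, ρ x := by rw [hone]; exact one_pos
  rw [integral_pos_iff_support_of_nonneg h0 hint] at hpos
  have hs : volume ({m} : Set (EuclideanSpace ℝ (Fin n))) = 0 := by simp
  rw [← measure_sdiff_null hs] at hpos
  refine hpos.trans_le (measure_mono fun x hx => ?_)
  have hxm : 0 < ‖x - m‖ := norm_pos_iff.2 (sub_ne_zero.2 hx.2)
  have hlt : Real.exp (-(δ * ‖x - m‖ ^ 2 / 2)) < 1 :=
    Real.exp_lt_one_iff.2 (neg_lt_zero.2 (by positivity))
  have hρx : ρ x ≠ 0 := hx.1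
  rw [Function.mem_support, tilt]
  intro h
  have : (1 - Real.exp (-(δ * ‖x - m‖ ^ 2 / 2))) * ρ x = 0 := by linarith
  rcases mul_eq_zero.1 this with h | h
  · linarith
  · exact hρx h

/-- A nonpositive variance would force the tilted mass to be at least 1, but the Gaussian weight is
below 1 off a single point, which is null as `1 ≤ n`. -/
theorem totalVar_pos (hn : 1 ≤ n) (h0 : ∀ x, 0 ≤ ρ x) (hint : Integrable ρ)
    (hone : ∫ x, ρ x = 1) (h2 : Integrable fun x => ‖x‖ ^ 2 * ρ x) {δ : ℝ} (hδ : 0 < δ)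
    {m : EuclideanSpace ℝ (Fin n)} (hm : ∀ y, tiltMass ρ (δ, y) ≤ tiltMass ρ (δ, m)) :
    0 < totalVar (densityMeasure ρ) := by
  have h1 := neg_log_tiltMass_le h0 hint hone h2 hδ hm
  have h3 : Real.log (tiltMass ρ (δ, m)) < 0 :=
    Real.log_neg (tiltMass_pos h0 hint (by rw [hone]; exact one_pos) hδ.le)
      (tiltMass_lt_one hn h0 hint hone hδ m)
  by_contra! h
  nlinarith

/-- The convolution of two Gaussian kernels is a Gaussian kernel. -/
theorem integral_gaussKernel_mul_gaussKernel {δ δ' κ : ℝ} (hδ : 0 < δ) (hδδ : δ < δ')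
    (hκ : κ = δ * δ' / (δ' - δ)) (x m : EuclideanSpace ℝ (Fin n)) :
    ∫ y, gaussKernel (δ', x - y) * gaussKernel (κ, y - m) =
      (Real.pi / ((δ' + κ) / 2)) ^ ((n : ℝ) / 2) * gaussKernel (δ, x - m) := by
  have hδ' : 0 < δ' := hδ.trans hδδ
  have hd : 0 < δ' - δ := sub_pos.2 hδδ
  have hκ0 : 0 < κ := by rw [hκ]; positivity
  -- The choice of `κ` means `1/δ = 1/δ' + 1/κ`; completing the square in `y` gives the centre `m +
  -- c • (x - m)` with `c = δ' / (δ' + κ)`.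
  set c : ℝ := 1 - δ / δ' with hc
  have h1 : (δ' + κ) * c = δ' := by rw [hκ, hc]; field_simp; ring
  have h2 : δ' * c = δ' - δ := by rw [hc]; field_simp
  have key : ∀ y, gaussKernel (δ', x - y) * gaussKernel (κ, y - m) =
      Real.exp (-((δ' + κ) / 2) * ‖y - (m + c • (x - m))‖ ^ 2) * gaussKernel (δ, x - m) := by
    intro y
    simp only [gaussKernel, ← Real.exp_add]
    congr 1
    have e1 : x - y = (x - m) - (y - m) := by abel
    have e2 : y - (m + c • (x - m)) = (y - m) - c • (x - m) := by abel
    rw [e1, e2]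
    generalize x - m = a, y - m = b
    rw [norm_sub_sq_real, norm_sub_sq_real, norm_smul, inner_smul_right,
      real_inner_comm a b, mul_pow, Real.norm_eq_abs, sq_abs]
    linear_combination (-⟪a, b⟫_ℝ + ‖a‖ ^ 2 * c / 2) * h1 + ‖a‖ ^ 2 / 2 * h2
  simp only [key]
  rw [integral_mul_const, integral_sub_right_eq_self
    (fun y : EuclideanSpace ℝ (Fin n) => Real.exp (-((δ' + κ) / 2) * ‖y‖ ^ 2)),
    GaussianFourier.integral_rexp_neg_mul_sq_norm (by positivity), finrank_euclideanSpace_fin]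

theorem integral_gaussKernel {κ : ℝ} (hκ : 0 < κ) (m : EuclideanSpace ℝ (Fin n)) :
    ∫ y, gaussKernel (κ, y - m) = (Real.pi / (κ / 2)) ^ ((n : ℝ) / 2) := by
  have h : (fun y : EuclideanSpace ℝ (Fin n) => gaussKernel (κ, y)) =
      fun y => Real.exp (-(κ / 2) * ‖y‖ ^ 2) := by
    ext y
    rw [gaussKernel]
    congr 1
    ring
  rw [integral_sub_right_eq_self (fun y : EuclideanSpace ℝ (Fin n) => gaussKernel (κ, y)) m, h,
    GaussianFourier.integral_rexp_neg_mul_sq_norm (by positivity), finrank_euclideanSpace_fin]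

/-- Up to a constant, the mass at `δ` is a Gaussian average over `y` of the mass at `δ'`. The
constant is the ratio of Gaussian integrals, from `(δ' + κ) / κ = δ' / δ`. -/
theorem tiltMass_le_of_lt (h0 : ∀ x, 0 ≤ ρ x) (hint : Integrable ρ) {δ δ' B : ℝ} (hδ : 0 < δ)
    (hδδ : δ < δ') (hB : ∀ y, tiltMass ρ (δ', y) ≤ B) (m : EuclideanSpace ℝ (Fin n)) :
    tiltMass ρ (δ, m) ≤ (δ' / δ) ^ ((n : ℝ) / 2) * B := by
  have hδ' : 0 < δ' := hδ.trans hδδ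
  have hd : 0 < δ' - δ := sub_pos.2 hδδ
  obtain ⟨κ, hκ⟩ : ∃ κ, κ = δ * δ' / (δ' - δ) := ⟨_, rfl⟩
  have hκ0 : 0 < κ := by rw [hκ]; positivity
  -- A non-integrable function would have Bochner integral 0, whereas the computed value is
  -- positive.
  have hgi : Integrable fun y : EuclideanSpace ℝ (Fin n) => gaussKernel (κ, y - m) := by
    by_contra h
    have := integral_gaussKernel hκ0 m
    rw [integral_undef h] at this
    have : 0 < (Real.pi / (κ / 2)) ^ ((n : ℝ) / 2) := by positivity
    linarith
  have hprod : Integrable (fun p : EuclideanSpace ℝ (Fin n) × EuclideanSpace ℝ (Fin n) =>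
      ρ p.1 * (gaussKernel (δ', p.1 - p.2) * gaussKernel (κ, p.2 - m))) (volume.prod volume) := by
    have h1 := (hint.mul_prod hgi).bdd_mul (c := 1)
      (f := fun p : EuclideanSpace ℝ (Fin n) × EuclideanSpace ℝ (Fin n) =>
        gaussKernel (δ', p.1 - p.2)) (Continuous.aestronglyMeasurable (by
          have := (contDiff_gaussKernel (E := EuclideanSpace ℝ (Fin n))).continuous
          fun_prop)) (ae_of_all _ fun p => by
        rw [Real.norm_of_nonneg (gaussKernel_pos _).le]
        exact exp_neg_mul_sq_le_one hδ'.le _)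
    refine h1.congr (ae_of_all _ fun p => ?_)
    simp only
    ring
  set A := (Real.pi / ((δ' + κ) / 2)) ^ ((n : ℝ) / 2) with hA
  set Z := (Real.pi / (κ / 2)) ^ ((n : ℝ) / 2) with hZ
  have hA0 : 0 < A := by positivity
  have e1 : A * tiltMass ρ (δ, m) = ∫ y, gaussKernel (κ, y - m) * tiltMass ρ (δ', y) := by
    calc A * tiltMass ρ (δ, m)
        = ∫ x, ∫ y, ρ x * (gaussKernel (δ', x - y) * gaussKernel (κ, y - m)) := by
          rw [tiltMass, ← integral_const_mul]
          congr 1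
          ext x
          rw [integral_const_mul, integral_gaussKernel_mul_gaussKernel hδ hδδ hκ, tilt_eq, hA]
          ring
      _ = ∫ y, ∫ x, ρ x * (gaussKernel (δ', x - y) * gaussKernel (κ, y - m)) :=
          integral_integral_swap hprod
      _ = _ := by
          congr 1
          ext y
          rw [tiltMass, ← integral_const_mul]
          congr 1
          ext x
          rw [tilt_eq]
          ring
  have e2 : A * tiltMass ρ (δ, m) ≤ Z * B := by
    rw [e1, hZ, ← integral_gaussKernel hκ0 m, ← integral_mul_const]
    refine integral_mono_of_nonneg (ae_of_all _ fun y => mul_nonneg (gaussKernel_pos _).le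
      (integral_nonneg fun x => mul_nonneg (Real.exp_pos _).le (h0 x))) (hgi.mul_const B)
      (ae_of_all _ fun y => mul_le_mul_of_nonneg_left (hB y) (gaussKernel_pos _).le)
  have e3 : Z = A * (δ' / δ) ^ ((n : ℝ) / 2) := by
    rw [hZ, hA, ← Real.mul_rpow (by positivity) (by positivity)]
    congr 1
    rw [hκ]
    field_simp
    ring
  rw [e3, mul_assoc] at e2
  exact le_of_mul_le_mul_left e2 hA0

theorem neg_log_tiltMass_le_of_le (h0 : ∀ x, 0 ≤ ρ x) (hint : Integrable ρ) (hpos : 0 < ∫ x, ρ x)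
    {δ δ' : ℝ} (hδ : 0 < δ) (hδδ : δ ≤ δ') {m m' : EuclideanSpace ℝ (Fin n)}
    (hm' : ∀ y, tiltMass ρ (δ', y) ≤ tiltMass ρ (δ', m')) :
    -Real.log (tiltMass ρ (δ', m')) ≤
      n / 2 * Real.log (δ' / δ) + -Real.log (tiltMass ρ (δ, m)) := by
  have hle : tiltMass ρ (δ, m) ≤ (δ' / δ) ^ ((n : ℝ) / 2) * tiltMass ρ (δ', m') := by
    rcases hδδ.eq_or_lt with rfl | h
    · rw [div_self hδ.ne', Real.one_rpow, one_mul]; exact hm' m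
    · exact tiltMass_le_of_lt h0 hint hδ h hm' m
  have hδ' : 0 < δ' := hδ.trans_le hδδ
  have hp : 0 < tiltMass ρ (δ', m') := tiltMass_pos h0 hint hpos hδ'.le
  have := Real.log_le_log (tiltMass_pos h0 hint hpos (p := (δ, m)) hδ.le) hle
  rw [Real.log_mul (by positivity) hp.ne', Real.log_rpow (by positivity)] at this
  linarith

end Bound

/-! ### The main theorem. -/

theorem mainTheorem3 (n : ℕ) (hn : 1 ≤ n)
    (V : EuclideanSpace ℝ (Fin n) → EReal) (hV : IsConvexFun V)
    (ρ : EuclideanSpace ℝ (Fin n) → ℝ) (hρ : ρ = expNeg V)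
    (hprob : Integrable ρ ∧ ∫ x, ρ x = 1) :
    -- the integrals below are finite
    Integrable (fun x => ‖x‖ ^ 2) (densityMeasure ρ) ∧
    (∀ δ : ℝ, 0 ≤ δ → ∀ m, Integrable (fun x => tilt ρ δ m x) ∧
      Integrable (fun x => tilt ρ δ m x • x)) ∧
    -- existence and uniqueness of the barycenter
    (∀ δ : ℝ, 0 < δ → ∃! m, IsBarycenter ρ δ m) ∧
    ∀ m : ℝ → EuclideanSpace ℝ (Fin n), (∀ δ : ℝ, 0 < δ → IsBarycenter ρ δ (m δ)) →
      -- it is the unique global maximizer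
      (∀ δ : ℝ, 0 < δ → ∀ y, y ≠ m δ → ∫ x, tilt ρ δ y x < ∫ x, tilt ρ δ (m δ) x) ∧
      -- dependence on the parameter
      (ContinuousOn m (Ioi 0) ∧ LocallyLipschitzOn (Ioi 0) m) ∧
      -- the bound (the value m 0 plays no role)
      (∀ δ : ℝ, 0 ≤ δ →
        -Real.log (∫ x, tilt ρ δ (m δ) x) ≤
          if δ < n / totalVar (densityMeasure ρ) then
            δ / 2 * totalVar (densityMeasure ρ)
          else
            n / 2 * (1 + Real.log (δ / n * totalVar (densityMeasure ρ)))) := by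
  obtain ⟨hint, hone⟩ := hprob
  have hLC : LogConcave fun x => ENNReal.ofReal (ρ x) := hρ ▸ hV.logConcave
  have h0 : ∀ x, 0 ≤ ρ x := fun x => hρ ▸ ENNReal.toReal_nonneg
  have hpos : 0 < ∫ x, ρ x := by rw [hone]; exact one_pos
  have h2 : Integrable fun x => ‖x‖ ^ 2 * ρ x := hLC.integrable_sq_norm_mul volume h0 hint
  refine ⟨(integrable_densityMeasure_iff h0 hint).2 h2, fun δ hδ m =>
    ⟨integrable_tilt hint hδ m, integrable_tilt_smul hint h2 hδ m⟩, fun δ hδ => ?_, fun m hm => ?_⟩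
  · obtain ⟨m, hm⟩ := exists_tiltMoment_eq_zero h0 hint hpos hδ
    refine ⟨m, (isBarycenter_iff hint h2 hδ.le m).2 hm, fun y hy => ?_⟩
    by_contra hne
    exact lt_asymm (tiltMass_lt_of_tiltMoment_eq_zero hLC h0 hint hpos hδ hm hne)
      (tiltMass_lt_of_tiltMoment_eq_zero hLC h0 hint hpos hδ
        ((isBarycenter_iff hint h2 hδ.le y).1 hy) (Ne.symm hne))
  have hm0 : ∀ δ, 0 < δ → tiltMoment ρ (δ, m δ) = 0 := fun δ hδ =>
    (isBarycenter_iff hint h2 hδ.le _).1 (hm δ hδ)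
  have hmax : ∀ δ : ℝ, 0 < δ → ∀ y, y ≠ m δ → tiltMass ρ (δ, y) < tiltMass ρ (δ, m δ) :=
    fun δ hδ y hy => tiltMass_lt_of_tiltMoment_eq_zero hLC h0 hint hpos hδ (hm0 δ hδ) hy
  have hmax' : ∀ δ : ℝ, 0 < δ → ∀ y, tiltMass ρ (δ, y) ≤ tiltMass ρ (δ, m δ) := fun δ hδ y => by
    by_cases h : y = m δ
    · rw [h]
    · exact (hmax δ hδ y h).le
  have hlip : LocallyLipschitzOn (Ioi 0) m := fun δ hδ => by
    obtain ⟨K, s, hs, hK⟩ :=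
      exists_lipschitzOnWith_of_tiltMoment_eq_zero hLC h0 hint hpos hm0 hδ
    exact ⟨K, s, mem_nhdsWithin_of_mem_nhds hs, hK⟩
  refine ⟨hmax, ⟨hlip.continuousOn, hlip⟩, fun δ hδ => ?_⟩
  change -Real.log (tiltMass ρ (δ, m δ)) ≤ _
  have hvar : 0 < totalVar (densityMeasure ρ) :=
    totalVar_pos hn h0 hint hone h2 one_pos (hmax' 1 one_pos)
  have hn0 : (0 : ℝ) < n := by exact_mod_cast hn
  set v := totalVar (densityMeasure ρ) with hv
  split_ifs with hlt
  -- At `δ = 0` the weight is 1 whatever `m 0` is, and both sides vanish.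
  · rcases hδ.eq_or_lt with rfl | hδ
    · simp [tiltMass, tilt, hone]
    · exact neg_log_tiltMass_le h0 hint hone h2 hδ (hmax' δ hδ)
  · have hd : 0 < n / v := by positivity
    have hle : n / v ≤ δ := not_lt.1 hlt
    -- At the threshold `n / v` the linear bound equals `n / 2`; the scaling comparison adds `n / 2
    -- * log (δ * v / n)`.
    have h3 := neg_log_tiltMass_le_of_le h0 hint hpos hd hle (m := m (n / v))
      (hmax' δ (hd.trans_le hle))
    have h4 := neg_log_tiltMass_le h0 hint hone h2 hd (hmax' _ hd)
    have e1 : n / v / 2 * v = (n : ℝ) / 2 := by field_simp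
    have e2 : δ / (n / v) = δ / n * v := by field_simp
    rw [← hv, e1] at h4
    rw [e2] at h3
    linarith
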